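/- Let $(M,\rho,\mu)$ be a metric space with a Borel measure $\mu$ such that $0<\mu(M)<\infty$. Balls are open, with centre $c_B$ and radius $r_B>0$; for $b>0$ let $\mathcal B_b$ be the family of balls with $r_B\le b$. Assume: (LD) for every $b>0$ there is a constant $D_b<\infty$ with $\mu(2B)\le D_b\,\mu(B)$ for all $B\in\mathcal B_b$; (AM) there are $R_0\in[0,\infty)$ and $\beta\in(1/2,1)$ such that for all $x,y\in M$ with $\rho(x,y)>R_0$ there is $z\in M$ with $\rho(x,z)<\beta\rho(x,y)$ and $\rho(y,z)<\beta\rho(x,y)$. All functions are complex valued. For $r\in(1,\infty]$, a $(1,r)$-standard atom supported in a ball $B$ is a function $a\in L^1(\mu)$ vanishing a.e. outside $B$ with $\int_B a\,d\mu=0$ and $\bigl(\frac1{\mu(B)}\int_B|a|^r\,d\mu\bigr)^{1/r}\le\mu(B)^{-1}$ (for $r=\infty$: $\|a\|_\infty\le\mu(B)^{-1}$); the exceptional atom is the constant $1/\mu(M)$. $H^{1,r}_b(\mu)$ is the space of all $g=\sum_k\lambda_ka_k$ (convergence in $L^1(\mu)$), where each $a_k$ is the exceptional atom or a $(1,r)$-standard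 atom supported in a ball of $\mathcal B_b$ and $\sum_k|\lambda_k|<\infty$; $\|g\|_{H^{1,r}_b}$ is the infimum of $\sum_k|\lambda_k|$ over all such decompositions of $g$. For $q\in[1,\infty)$ and $f\in L^1(\mu)$ let $$N_b^q(f)=\sup_{B\in\mathcal B_b}\Bigl(\frac1{\mu(B)}\int_B|f-f_B|^q\,d\mu\Bigr)^{1/q}\in[0,\infty],\qquad f_B=\frac1{\mu(B)}\int_Bf\,d\mu,$$ and let $BMO_b^q(\mu)=\{f\in L^1(\mu):N_b^q(f)<\infty\}$ with norm $\|f\|_1+N_b^q(f)$. Let $r\in(1,\infty]$, $q\in[1,\infty)$ and $R_0/(1-\beta)<c<b$. Then: (i) $H^{1,r}_c(\mu)$, $H^{1,r}_b(\mu)$, $BMO^q_b(\mu)$, $BMO^q_c(\mu)$ are Banach spaces, and the identity is a Banach space isomorphism (linear homeomorphism) of $H^{1,r}_c(\mu)$ onto $H^{1,r}_b(\mu)$ and of $BMO^q_b(\mu)$ onto $BMO^q_c(\mu)$; that is, the spaces coincide and their norms are equivalent. (ii) (John–Nirenberg type inequality) There are positive constants $\kappa$ and $C$ such that for all $f\in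 BMO_b^1(\mu)$, all $B\in\mathcal B_b$ and all $s\ge0$ $$\mu\bigl(\{x\in B:|f(x)-f_B|>s\}\bigr)\le C\,e^{-\kappa s/N_b^1(f)}\,\mu(B),$$ where the right-hand side is read as $0$ if $N_b^1(f)=0$. (iii) For each $p\in(1,\infty)$ there is a constant $C<\infty$ such that $N_b^1(f)\le N_b^p(f)\le C\,N_b^1(f)$, as elements of $[0,\infty]$, for all $f\in L^1(\mu)$; in particular $BMO^p_b(\mu)=BMO^1_b(\mu)$. -/

import Mathlib

open MeasureTheory Metric
open scoped ENNReal NNReal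

universe u

/-- Local doubling property (LD): for every scale `b > 0` there is a finite constant `D` with
`μ (2B) ≤ D μ B` for every (open) ball `B` of radius at most `b`. -/
def LocallyDoubling {M : Type u} [MetricSpace M] [MeasurableSpace M] (μ : Measure M) : Prop :=
  ∀ b : ℝ, 0 < b → ∃ D : ℝ≥0, ∀ (x : M) (ρ : ℝ), 0 < ρ → ρ ≤ b →
    μ (ball x (2 * ρ)) ≤ D * μ (ball x ρ)

/-- Approximate midpoint property (AM) with constants `R₀ ∈ [0, ∞)` and `β ∈ (1/2, 1)`. -/
def ApproximateMidpoint (M : Type u) [MetricSpace M] (R₀ β : ℝ) : Prop :=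
  0 ≤ R₀ ∧ 1 / 2 < β ∧ β < 1 ∧
    ∀ x y : M, R₀ < dist x y → ∃ z : M, dist x z < β * dist x y ∧ dist y z < β * dist x y

section Hardy

variable {M : Type u} [MetricSpace M] [MeasurableSpace M]

/-- `a` is a `(1,r)`-standard atom supported in a ball `B` of radius at most `b`.
`ProbabilityTheory.cond μ B` is the normalised restriction `μ(B)⁻¹ • μ|_B`, so that
`eLpNorm a r (ProbabilityTheory.cond μ B)` is `(μ(B)⁻¹ ∫_B |a|^r dμ)^{1/r}` for `r < ∞` and the
essential supremum of `|a|` on `B` for `r = ∞`. -/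
def IsStandardAtom (μ : Measure M) (b : ℝ) (r : ℝ≥0∞) (a : Lp ℂ 1 μ) : Prop :=
  ∃ (x : M) (ρ : ℝ), 0 < ρ ∧ ρ ≤ b ∧
    (∀ᵐ y ∂μ, y ∉ ball x ρ → a y = 0) ∧
    eLpNorm a r (ProbabilityTheory.cond μ (ball x ρ)) ≤ (μ (ball x ρ))⁻¹ ∧
    ∫ y in ball x ρ, a y ∂μ = 0

/-- The exceptional atom: the constant function `1 / μ(M)`. -/
noncomputable def exceptionalAtom {M : Type u} [MeasurableSpace M] (μ : Measure M) [IsFiniteMeasure μ] : Lp ℂ 1 μ :=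
  Lp.const 1 μ ((1 / μ.real Set.univ : ℝ) : ℂ)

/-- `g = ∑ k, l k • a k` (convergence in `L¹(μ)`) where each `a k` is either a `(1,r)`-standard
atom supported in a ball of radius at most `b` or the exceptional atom, and `∑ k, |l k| < ∞`. -/
def IsAtomicDecomposition (μ : Measure M) [IsFiniteMeasure μ] (b : ℝ) (r : ℝ≥0∞)
    (g : Lp ℂ 1 μ) (l : ℕ → ℂ) (a : ℕ → Lp ℂ 1 μ) : Prop :=
  (∀ k, IsStandardAtom μ b r (a k) ∨ a k = exceptionalAtom μ) ∧
    Summable (fun k => ‖l k‖) ∧ HasSum (fun k => l k • a k) g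

theorem IsAtomicDecomposition.smul {μ : Measure M} [IsFiniteMeasure μ] {b : ℝ} {r : ℝ≥0∞}
    {g : Lp ℂ 1 μ} {l : ℕ → ℂ} {a : ℕ → Lp ℂ 1 μ} (h : IsAtomicDecomposition μ b r g l a)
    (z : ℂ) : IsAtomicDecomposition μ b r (z • g) (fun k => z * l k) a := by
  refine ⟨h.1, ?_, ?_⟩
  · simpa only [norm_mul] using h.2.1.mul_left ‖z‖
  · simpa only [smul_smul] using h.2.2.const_smul z

theorem IsAtomicDecomposition.add {μ : Measure M} [IsFiniteMeasure μ] {b : ℝ} {r : ℝ≥0∞}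
    {g g' : Lp ℂ 1 μ} {l l' : ℕ → ℂ} {a a' : ℕ → Lp ℂ 1 μ}
    (h : IsAtomicDecomposition μ b r g l a) (h' : IsAtomicDecomposition μ b r g' l' a') :
    ∃ l'' a'', IsAtomicDecomposition μ b r (g + g') l'' a'' ∧
      ∑' k, ‖l'' k‖ = ∑' k, ‖l k‖ + ∑' k, ‖l' k‖ := by
  have e := Equiv.natSumNatEquivNat
  have hl : HasSum (fun i : ℕ ⊕ ℕ => ‖Sum.elim l l' i‖) (∑' k, ‖l k‖ + ∑' k, ‖l' k‖) :=
    HasSum.sum h.2.1.hasSum h'.2.1.hasSum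
  have hl2 : HasSum (fun k => ‖Sum.elim l l' (e.symm k)‖) (∑' k, ‖l k‖ + ∑' k, ‖l' k‖) :=
    (Equiv.hasSum_iff e.symm (f := fun i => ‖Sum.elim l l' i‖)).2 hl
  have hg : HasSum (fun i : ℕ ⊕ ℕ => Sum.elim l l' i • Sum.elim a a' i) (g + g') :=
    HasSum.sum h.2.2 h'.2.2
  refine ⟨fun k => Sum.elim l l' (e.symm k), fun k => Sum.elim a a' (e.symm k),
    ⟨fun k => ?_, hl2.summable, ?_⟩, hl2.tsum_eq⟩
  · have hk : ∀ i, IsStandardAtom μ b r (Sum.elim a a' i) ∨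
        Sum.elim a a' i = exceptionalAtom μ := by
      rintro (i | i)
      · exact h.1 i
      · exact h'.1 i
    exact hk _
  · exact (Equiv.hasSum_iff e.symm (f := fun i => Sum.elim l l' i • Sum.elim a a' i)).2 hg

theorem isAtomicDecomposition_zero (μ : Measure M) [IsFiniteMeasure μ] (b : ℝ) (r : ℝ≥0∞) :
    IsAtomicDecomposition μ b r 0 (fun _ => 0) (fun _ => exceptionalAtom μ) :=
  ⟨fun _ => Or.inr rfl, by simp, by simp⟩

/-- The elements of `L¹(μ)` that admit an atomic decomposition at the scale `b`. -/
def hardySubmodule (μ : Measure M) [IsFiniteMeasure μ] (b : ℝ) (r : ℝ≥0∞) :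
    Submodule ℂ (Lp ℂ 1 μ) where
  carrier := {g | ∃ l a, IsAtomicDecomposition μ b r g l a}
  zero_mem' := ⟨_, _, isAtomicDecomposition_zero μ b r⟩
  add_mem' := by
    rintro g g' ⟨l, a, h⟩ ⟨l', a', h'⟩
    obtain ⟨l'', a'', h'', -⟩ := h.add h'
    exact ⟨l'', a'', h''⟩
  smul_mem' := by
    rintro z g ⟨l, a, h⟩
    exact ⟨_, _, h.smul z⟩

/-- The Hardy space `H_b^{1,r}(μ)`. Its norm is not the one of `L¹(μ)`; see below. -/
def HardySpace (μ : Measure M) [IsFiniteMeasure μ] (b : ℝ) (r : ℝ≥0∞) : Type u :=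
  hardySubmodule μ b r

noncomputable instance (μ : Measure M) [IsFiniteMeasure μ] (b : ℝ) (r : ℝ≥0∞) :
    AddCommGroup (HardySpace μ b r) :=
  inferInstanceAs (AddCommGroup (hardySubmodule μ b r))

noncomputable instance (μ : Measure M) [IsFiniteMeasure μ] (b : ℝ) (r : ℝ≥0∞) :
    Module ℂ (HardySpace μ b r) :=
  inferInstanceAs (Module ℂ (hardySubmodule μ b r))

/-- The inclusion of `H_b^{1,r}(μ)` in `L¹(μ)`. -/
noncomputable def HardySpace.toL1 {μ : Measure M} [IsFiniteMeasure μ] {b : ℝ} {r : ℝ≥0∞} :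
    HardySpace μ b r →ₗ[ℂ] Lp ℂ 1 μ :=
  (hardySubmodule μ b r).subtype

/-- The norm of `H_b^{1,r}(μ)`: the infimum of `∑ k, |l k|` over all atomic decompositions. -/
noncomputable instance (μ : Measure M) [IsFiniteMeasure μ] (b : ℝ) (r : ℝ≥0∞) :
    Norm (HardySpace μ b r) where
  norm g := sInf {t : ℝ | ∃ l a, IsAtomicDecomposition μ b r g.toL1 l a ∧ t = ∑' k, ‖l k‖}

theorem HardySpace.norm_le {μ : Measure M} [IsFiniteMeasure μ] {b : ℝ} {r : ℝ≥0∞}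
    {g : HardySpace μ b r} {l : ℕ → ℂ} {a : ℕ → Lp ℂ 1 μ}
    (h : IsAtomicDecomposition μ b r g.toL1 l a) : ‖g‖ ≤ ∑' k, ‖l k‖ := by
  refine csInf_le ⟨0, ?_⟩ ⟨l, a, h, rfl⟩
  rintro t ⟨l, a, -, rfl⟩
  exact tsum_nonneg fun _ => norm_nonneg _

theorem HardySpace.le_norm {μ : Measure M} [IsFiniteMeasure μ] {b : ℝ} {r : ℝ≥0∞}
    {g : HardySpace μ b r} {t : ℝ}
    (h : ∀ l a, IsAtomicDecomposition μ b r g.toL1 l a → t ≤ ∑' k, ‖l k‖) : t ≤ ‖g‖ := by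
  obtain ⟨l, a, hg⟩ := g.2
  refine le_csInf ⟨_, l, a, hg, rfl⟩ ?_
  rintro s ⟨l, a, h', rfl⟩
  exact h l a h'

theorem HardySpace.norm_smul_le' {μ : Measure M} [IsFiniteMeasure μ] {b : ℝ} {r : ℝ≥0∞}
    (z : ℂ) (g : HardySpace μ b r) : ‖z • g‖ ≤ ‖z‖ * ‖g‖ := by
  by_cases hz : z = 0
  · subst hz
    have := HardySpace.norm_le (g := (0 : ℂ) • g) (b := b) (r := r)
      (by rw [zero_smul, map_zero]; exact isAtomicDecomposition_zero μ b r)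
    simpa using this
  · have hz' : 0 < ‖z‖ := norm_pos_iff.2 hz
    rw [← div_le_iff₀' hz']
    refine HardySpace.le_norm fun l a h => ?_
    rw [div_le_iff₀' hz', ← tsum_mul_left]
    have := HardySpace.norm_le (g := z • g) (by rw [map_smul]; exact h.smul z)
    simpa using this

theorem IsStandardAtom.norm_le_one [OpensMeasurableSpace M] {μ : Measure M} [IsFiniteMeasure μ]
    {b : ℝ} {r : ℝ≥0∞} (hr : 1 ≤ r) {a : Lp ℂ 1 μ} (h : IsStandardAtom μ b r a) : ‖a‖ ≤ 1 := by
  obtain ⟨x, ρ, -, -, hs, ha, -⟩ := h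
  have hB : MeasurableSet (ball x ρ) := measurableSet_ball
  have hres : eLpNorm a 1 μ = eLpNorm a 1 (μ.restrict (ball x ρ)) := by
    rw [← eLpNorm_indicator_eq_eLpNorm_restrict hB]
    refine eLpNorm_congr_ae ?_
    filter_upwards [hs] with y hy
    by_cases h' : y ∈ ball x ρ
    · simp [h']
    · simp [h', hy h']
  have key : eLpNorm a 1 μ ≤ 1 := by
    rw [hres]
    by_cases h0 : μ (ball x ρ) = 0
    · rw [Measure.restrict_eq_zero.2 h0]; simp
    · have := ProbabilityTheory.cond_isProbabilityMeasure h0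
      have h1 : eLpNorm a 1 (ProbabilityTheory.cond μ (ball x ρ)) ≤ (μ (ball x ρ))⁻¹ :=
        (eLpNorm_le_eLpNorm_of_exponent_le hr
          ((Lp.aestronglyMeasurable a).mono_ac
            ProbabilityTheory.cond_absolutelyContinuous)).trans ha
      rw [ProbabilityTheory.cond, eLpNorm_one_smul_measure] at h1
      calc eLpNorm a 1 (μ.restrict (ball x ρ))
          = μ (ball x ρ) * ((μ (ball x ρ))⁻¹ * eLpNorm a 1 (μ.restrict (ball x ρ))) := by
            rw [← mul_assoc, ENNReal.mul_inv_cancel h0 (measure_ne_top _ _), one_mul]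
        _ ≤ μ (ball x ρ) * (μ (ball x ρ))⁻¹ := by gcongr
        _ ≤ 1 := ENNReal.mul_inv_le_one _
  rw [Lp.norm_def]
  exact ENNReal.toReal_le_of_le_ofReal zero_le_one (by simpa using key)

theorem norm_exceptionalAtom_le {M : Type u} [MeasurableSpace M] (μ : Measure M) [IsFiniteMeasure μ] :
    ‖exceptionalAtom μ‖ ≤ 1 := by
  have h := Lp.norm_const_le (p := 1) (μ := μ) (c := ((1 / μ.real Set.univ : ℝ) : ℂ))
  have h2 : ‖((1 / μ.real Set.univ : ℝ) : ℂ)‖ = 1 / μ.real Set.univ := by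
    rw [Complex.norm_real, Real.norm_of_nonneg (by positivity)]
  rw [h2] at h
  refine h.trans ?_
  simpa using inv_mul_le_one (a := μ.real Set.univ)

theorem HardySpace.norm_toL1_le [OpensMeasurableSpace M] {μ : Measure M} [IsFiniteMeasure μ]
    {b : ℝ} {r : ℝ≥0∞} (hr : 1 ≤ r) (g : HardySpace μ b r) : ‖g.toL1‖ ≤ ‖g‖ := by
  refine HardySpace.le_norm fun l a h => ?_
  rw [← h.2.2.tsum_eq]
  refine tsum_of_norm_bounded h.2.1.hasSum fun k => ?_
  rw [norm_smul]
  refine mul_le_of_le_one_right (norm_nonneg _) ?_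
  rcases h.1 k with hk | hk
  · exact hk.norm_le_one hr
  · rw [hk]; exact norm_exceptionalAtom_le μ

theorem HardySpace.normCore [OpensMeasurableSpace M] (μ : Measure M) [IsFiniteMeasure μ]
    (b : ℝ) (r : ℝ≥0∞) [hr : Fact (1 < r)] : NormedSpace.Core ℂ (HardySpace μ b r) where
  norm_nonneg g := HardySpace.le_norm fun l a _ => tsum_nonneg fun _ => norm_nonneg _
  norm_smul z g := by
    refine le_antisymm (HardySpace.norm_smul_le' z g) ?_
    by_cases hz : z = 0
    · rw [hz, norm_zero, zero_mul]
      exact HardySpace.le_norm fun l a _ => tsum_nonneg fun _ => norm_nonneg _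
    · have := HardySpace.norm_smul_le' z⁻¹ (z • g)
      rw [smul_smul, inv_mul_cancel₀ hz, one_smul, norm_inv] at this
      rwa [← div_eq_inv_mul, le_div_iff₀' (norm_pos_iff.2 hz)] at this
  norm_triangle g g' := by
    rw [← sub_le_iff_le_add]
    refine HardySpace.le_norm fun l a h => ?_
    rw [sub_le_iff_le_add, ← sub_le_iff_le_add']
    refine HardySpace.le_norm fun l' a' h' => ?_
    obtain ⟨l'', a'', h'', hs⟩ := h.add h'
    rw [sub_le_iff_le_add', ← hs]
    exact HardySpace.norm_le (by rw [map_add]; exact h'')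
  norm_eq_zero_iff g := by
    constructor
    · intro h
      have h1 := HardySpace.norm_toL1_le hr.out.le g
      rw [h] at h1
      exact Subtype.ext (norm_le_zero_iff.1 h1)
    · rintro rfl
      refine le_antisymm ?_ (HardySpace.le_norm fun l a _ => tsum_nonneg fun _ => norm_nonneg _)
      have := HardySpace.norm_le (g := (0 : HardySpace μ b r))
        (by rw [map_zero]; exact isAtomicDecomposition_zero μ b r)
      simpa using this

noncomputable instance [OpensMeasurableSpace M] (μ : Measure M) [IsFiniteMeasure μ]
    (b : ℝ) (r : ℝ≥0∞) [Fact (1 < r)] : NormedAddCommGroup (HardySpace μ b r) :=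
  NormedAddCommGroup.ofCore (HardySpace.normCore μ b r)

noncomputable instance [OpensMeasurableSpace M] (μ : Measure M) [IsFiniteMeasure μ]
    (b : ℝ) (r : ℝ≥0∞) [Fact (1 < r)] : NormedSpace ℂ (HardySpace μ b r) :=
  NormedSpace.ofCore (HardySpace.normCore μ b r)

end Hardy

section BMO

variable {M : Type u} [MetricSpace M] [MeasurableSpace M]

/-- The mean oscillation seminorm `N_b^q(f)`, with values in `[0, ∞]`: the supremum over all balls
`B` of radius at most `b` of `(μ(B)⁻¹ ∫_B |f - f_B|^q dμ)^{1/q}`, `f_B` the average of `f` on `B`.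
(`ProbabilityTheory.cond μ B` is the normalised restriction `μ(B)⁻¹ • μ|_B`.) -/
noncomputable def oscNorm (μ : Measure M) (b : ℝ) (q : ℝ≥0∞) (f : M → ℂ) : ℝ≥0∞ :=
  ⨆ (x : M) (ρ : ℝ) (_ : 0 < ρ ∧ ρ ≤ b),
    eLpNorm (fun y => f y - ⨍ z in ball x ρ, f z ∂μ) q (ProbabilityTheory.cond μ (ball x ρ))

theorem oscNorm_congr {μ : Measure M} (b : ℝ) (q : ℝ≥0∞) {f g : M → ℂ} (h : f =ᵐ[μ] g) :
    oscNorm μ b q f = oscNorm μ b q g := by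
  unfold oscNorm
  refine iSup_congr fun x => iSup_congr fun ρ => iSup_congr fun _ => ?_
  have havg : ⨍ z in ball x ρ, f z ∂μ = ⨍ z in ball x ρ, g z ∂μ :=
    average_congr (ae_restrict_of_ae h)
  rw [havg]
  refine eLpNorm_congr_ae ?_
  filter_upwards [ProbabilityTheory.cond_absolutelyContinuous.ae_le h] with y hy
  rw [hy]

theorem oscNorm_add_le {μ : Measure M} (b : ℝ) {q : ℝ≥0∞} (hq : 1 ≤ q) {f g : M → ℂ}
    (hf : Integrable f μ) (hg : Integrable g μ) :
    oscNorm μ b q (f + g) ≤ oscNorm μ b q f + oscNorm μ b q g := by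
  refine iSup_le fun x => iSup₂_le fun ρ hρ => ?_
  have havg : ⨍ z in ball x ρ, (f + g) z ∂μ
      = (⨍ z in ball x ρ, f z ∂μ) + ⨍ z in ball x ρ, g z ∂μ := by
    simp only [setAverage_eq, Pi.add_apply]
    rw [integral_add hf.integrableOn hg.integrableOn, smul_add]
  have hfun : (fun y => (f + g) y - ⨍ z in ball x ρ, (f + g) z ∂μ)
      = (fun y => f y - ⨍ z in ball x ρ, f z ∂μ) + (fun y => g y - ⨍ z in ball x ρ, g z ∂μ) := by
    funext y
    rw [havg]
    simp only [Pi.add_apply]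
    ring
  rw [hfun]
  refine (eLpNorm_add_le ?_ ?_ hq).trans ?_
  · exact (hf.aestronglyMeasurable.mono_ac ProbabilityTheory.cond_absolutelyContinuous).sub
      aestronglyMeasurable_const
  · exact (hg.aestronglyMeasurable.mono_ac ProbabilityTheory.cond_absolutelyContinuous).sub
      aestronglyMeasurable_const
  · refine add_le_add ?_ ?_
    · exact le_iSup_of_le x (le_iSup₂_of_le ρ hρ le_rfl)
    · exact le_iSup_of_le x (le_iSup₂_of_le ρ hρ le_rfl)

theorem oscNorm_const_smul {μ : Measure M} (b : ℝ) (q : ℝ≥0∞) (z : ℂ) (f : M → ℂ) :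
    oscNorm μ b q (z • f) = ‖z‖ₑ * oscNorm μ b q f := by
  unfold oscNorm
  simp only [ENNReal.mul_iSup]
  refine iSup_congr fun x => iSup_congr fun ρ => iSup_congr fun _ => ?_
  rw [← eLpNorm_const_smul]
  congr 1
  funext y
  simp only [setAverage_eq, Pi.smul_apply, integral_smul, smul_sub]
  rw [smul_comm]

/-- The elements of `L¹(μ)` with `N_b^q(f) < ∞`. -/
noncomputable def bmoSubmodule (μ : Measure M) (b : ℝ) (q : ℝ≥0∞) [hq : Fact (1 ≤ q)] :
    Submodule ℂ (Lp ℂ 1 μ) where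
  carrier := {f | oscNorm μ b q f < ∞}
  zero_mem' := by
    have h : oscNorm μ b q (0 : Lp ℂ 1 μ) = 0 := by
      rw [oscNorm_congr b q (Lp.coeFn_zero ℂ 1 μ)]
      simp [oscNorm]
    exact h.trans_lt ENNReal.zero_lt_top
  add_mem' := by
    intro f g hf hg
    have h := oscNorm_add_le b hq.out (L1.integrable_coeFn f) (L1.integrable_coeFn g)
    rw [← oscNorm_congr b q (Lp.coeFn_add f g)] at h
    exact h.trans_lt (ENNReal.add_lt_top.2 ⟨hf, hg⟩)
  smul_mem' := by
    intro z f hf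
    change oscNorm μ b q (z • f : Lp ℂ 1 μ) < ∞
    rw [oscNorm_congr b q (Lp.coeFn_smul z f), oscNorm_const_smul]
    exact ENNReal.mul_lt_top enorm_lt_top hf

/-- The space `BMO_b^q(μ)`. Its norm is not the one of `L¹(μ)`; see below. -/
def BMOSpace (μ : Measure M) (b : ℝ) (q : ℝ≥0∞) [Fact (1 ≤ q)] : Type u :=
  bmoSubmodule μ b q

noncomputable instance (μ : Measure M) (b : ℝ) (q : ℝ≥0∞) [Fact (1 ≤ q)] :
    AddCommGroup (BMOSpace μ b q) :=
  inferInstanceAs (AddCommGroup (bmoSubmodule μ b q))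

noncomputable instance (μ : Measure M) (b : ℝ) (q : ℝ≥0∞) [Fact (1 ≤ q)] :
    Module ℂ (BMOSpace μ b q) :=
  inferInstanceAs (Module ℂ (bmoSubmodule μ b q))

/-- The inclusion of `BMO_b^q(μ)` in `L¹(μ)`. -/
noncomputable def BMOSpace.toL1 {μ : Measure M} {b : ℝ} {q : ℝ≥0∞} [Fact (1 ≤ q)] :
    BMOSpace μ b q →ₗ[ℂ] Lp ℂ 1 μ :=
  (bmoSubmodule μ b q).subtype

/-- The norm of `BMO_b^q(μ)`: `‖f‖₁ + N_b^q(f)`. -/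
noncomputable instance (μ : Measure M) (b : ℝ) (q : ℝ≥0∞) [Fact (1 ≤ q)] :
    Norm (BMOSpace μ b q) where
  norm f := ‖f.toL1‖ + (oscNorm μ b q f.toL1).toReal

theorem BMOSpace.norm_def {μ : Measure M} {b : ℝ} {q : ℝ≥0∞} [Fact (1 ≤ q)]
    (f : BMOSpace μ b q) : ‖f‖ = ‖f.toL1‖ + (oscNorm μ b q f.toL1).toReal := rfl

theorem BMOSpace.normCore (μ : Measure M) (b : ℝ) (q : ℝ≥0∞) [hq : Fact (1 ≤ q)] :
    NormedSpace.Core ℂ (BMOSpace μ b q) where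
  norm_nonneg f := add_nonneg (norm_nonneg _) ENNReal.toReal_nonneg
  norm_smul z f := by
    rw [BMOSpace.norm_def, BMOSpace.norm_def, map_smul, norm_smul,
      oscNorm_congr b q (Lp.coeFn_smul z f.toL1), oscNorm_const_smul, ENNReal.toReal_mul,
      toReal_enorm, mul_add]
  norm_triangle f g := by
    have h := oscNorm_add_le b hq.out (L1.integrable_coeFn f.toL1) (L1.integrable_coeFn g.toL1)
    rw [← oscNorm_congr b q (Lp.coeFn_add f.toL1 g.toL1)] at h
    have hf : oscNorm μ b q f.toL1 ≠ ∞ := ne_of_lt f.2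
    have hg : oscNorm μ b q g.toL1 ≠ ∞ := ne_of_lt g.2
    have h2 := ENNReal.toReal_mono (ENNReal.add_ne_top.2 ⟨hf, hg⟩) h
    rw [ENNReal.toReal_add hf hg] at h2
    rw [BMOSpace.norm_def, BMOSpace.norm_def, BMOSpace.norm_def, map_add]
    have h3 := norm_add_le f.toL1 g.toL1
    linarith
  norm_eq_zero_iff f := by
    constructor
    · intro h
      rw [BMOSpace.norm_def] at h
      have h1 : ‖f.toL1‖ ≤ 0 := by
        have := ENNReal.toReal_nonneg (a := oscNorm μ b q f.toL1)
        linarith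
      exact Subtype.ext (norm_le_zero_iff.1 h1)
    · rintro rfl
      rw [BMOSpace.norm_def, map_zero, oscNorm_congr b q (Lp.coeFn_zero ℂ 1 μ)]
      simp [oscNorm]

noncomputable instance (μ : Measure M) (b : ℝ) (q : ℝ≥0∞) [Fact (1 ≤ q)] :
    NormedAddCommGroup (BMOSpace μ b q) :=
  NormedAddCommGroup.ofCore (BMOSpace.normCore μ b q)

noncomputable instance (μ : Measure M) (b : ℝ) (q : ℝ≥0∞) [Fact (1 ≤ q)] :
    NormedSpace ℂ (BMOSpace μ b q) :=
  NormedSpace.ofCore (BMOSpace.normCore μ b q)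

end BMO

/-! Two geometric facts carry the proof. Local doubling makes the measures of `ball x R` and `ball x
η` comparable uniformly in `x`, so balls of radius at most `b` are covered by a bounded number of
`η`-balls. The approximate midpoint property allows repeated bisection: a pseudodistance bounded by
`A` on pairs at distance at most `δ`, where `δ ≥ R₀`, is bounded by a fixed multiple of `A` on pairs
within any prescribed distance (`ApproximateMidpoint.exists_chain_bound`).

The chain bound is used for two pseudodistances. The difference of the averages of `f` over two
`η`-balls gives control of the oscillation at scale `b` by that at scale `c`
(`oscNorm_le_mul_oscNorm`). The Hardy norm of the difference of two normalised indicators gives the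
dual statement (`exists_hardyENorm_standardAtom_le`): an atom of a large ball is cut along a cover,
each piece is given mean zero by subtracting a bump, and the bumps, whose total mass is zero, are
carried to a common centre.

The John-Nirenberg inequality comes from a Calderón-Zygmund stopping time
(`LocallyDoubling.exists_stopping_balls`). Each ball is replaced by balls of at most half its
measure in total, on which the average has moved by at most a multiple of the seminorm; iteration
gives geometric decay. The stopping argument looks at the doubled ball, so it uses the oscillation
at scale `2b`, which the change of scale brings back to `b`. Summing the decay over level sets
compares the seminorms for different exponents. Completeness rests on lower semicontinuity of the
oscillation for BMO and on merging atomic decompositions for the Hardy space. -/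

/-! ### Consequences of local doubling: positivity, separability, finite covers. -/

section Doubling

variable {M : Type*} [MetricSpace M] [MeasurableSpace M] {μ : Measure M}

theorem LocallyDoubling.exists_measure_ball_pow_mul_le (hLD : LocallyDoubling μ) {b : ℝ}
    (hb : 0 < b) (n : ℕ) : ∃ K : ℝ≥0, 1 ≤ K ∧ ∀ (x : M) (t : ℝ), 0 < t → t ≤ b →
      μ (ball x (2 ^ n * t)) ≤ K * μ (ball x t) := by
  induction n with
  | zero => exact ⟨1, le_rfl, fun x => by simp⟩
  | succ n ih =>
    obtain ⟨K, hK, h⟩ := ih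
    obtain ⟨D, hD⟩ := hLD (2 ^ n * b) (by positivity)
    refine ⟨max D 1 * K, one_le_mul (le_max_right _ _) hK, fun x t ht htb => ?_⟩
    calc μ (ball x (2 ^ (n + 1) * t)) = μ (ball x (2 * (2 ^ n * t))) := by
          congr 2; ring
      _ ≤ D * μ (ball x (2 ^ n * t)) := hD x _ (by positivity) (by gcongr)
      _ ≤ (max D 1 : ℝ≥0) * (K * μ (ball x t)) := by
          gcongr
          · exact le_max_left _ _
          · exact h x t ht htb
      _ = _ := by rw [← mul_assoc, ENNReal.coe_mul]

theorem LocallyDoubling.exists_measure_ball_le (hLD : LocallyDoubling μ) {η : ℝ} (hη : 0 < η)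
    (R : ℝ) : ∃ K : ℝ≥0, 1 ≤ K ∧ ∀ x : M, μ (ball x R) ≤ K * μ (ball x η) := by
  obtain ⟨n, hn⟩ := pow_unbounded_of_one_lt (R / η) (one_lt_two)
  obtain ⟨K, hK, h⟩ := hLD.exists_measure_ball_pow_mul_le hη n
  refine ⟨K, hK, fun x => le_trans (measure_mono (ball_subset_ball ?_)) (h x η hη le_rfl)⟩
  exact ((div_lt_iff₀ hη).1 hn).le

/-- If one ball were null, doubling would make all concentric balls null, and these exhaust `M`. -/
theorem LocallyDoubling.measure_ball_pos (hLD : LocallyDoubling μ) [NeZero μ] (x : M) {ρ : ℝ}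
    (hρ : 0 < ρ) : 0 < μ (ball x ρ) := by
  rw [pos_iff_ne_zero]
  intro h
  refine NeZero.ne μ (Measure.measure_univ_eq_zero.1 ?_)
  rw [← iUnion_ball_nat x, measure_iUnion_null_iff]
  intro n
  obtain ⟨K, -, hK⟩ := hLD.exists_measure_ball_le hρ n
  simpa [h] using hK x

/-- This gives access to Lebesgue differentiation. The constant is squared because passing from
closed to open balls costs one more doubling. -/
theorem LocallyDoubling.isUnifLocDoublingMeasure (hLD : LocallyDoubling μ) :
    IsUnifLocDoublingMeasure μ := by
  obtain ⟨D, hD⟩ := hLD 2 (by norm_num)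
  refine ⟨D * D, ?_⟩
  filter_upwards [Ioc_mem_nhdsGT (zero_lt_one)] with ε hε x
  calc μ (closedBall x (2 * ε)) ≤ μ (ball x (2 * (2 * ε))) :=
        measure_mono (closedBall_subset_ball (by linarith [hε.1]))
    _ ≤ D * μ (ball x (2 * ε)) := hD x _ (by linarith [hε.1]) (by linarith [hε.2])
    _ ≤ D * (D * μ (ball x ε)) := by
        gcongr
        exact hD x _ (by linarith [hε.1]) (by linarith [hε.2])
    _ ≤ (D * D : ℝ≥0) * μ (closedBall x ε) := by
        rw [ENNReal.coe_mul, mul_assoc]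
        gcongr
        exact ball_subset_closedBall

variable [OpensMeasurableSpace M]

/-- A disjoint family of balls of positive measure is countable when the total measure is finite;
the centres of a Vitali family of radius `ε / 4` form a countable `ε`-net. -/
theorem LocallyDoubling.secondCountableTopology (hLD : LocallyDoubling μ) [NeZero μ]
    [IsFiniteMeasure μ] : SecondCountableTopology M := by
  refine secondCountable_of_almost_dense_set fun ε hε => ?_
  obtain ⟨u, -, hu, hcov⟩ := Vitali.exists_disjoint_subfamily_covering_enlargement_closedBall
    (Set.univ : Set M) id (fun _ => ε / 4) (ε / 4) (fun _ _ => le_rfl) 4 (by norm_num)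
  refine ⟨u, ?_, fun x => ?_⟩
  · have := Measure.countable_meas_pos_of_disjoint_iUnion (μ := μ)
      (As := fun i : u => closedBall (i : M) (ε / 4)) (fun _ => measurableSet_closedBall)
      (fun i j hij => hu i.2 j.2 (fun h => hij (Subtype.ext h)))
    rw [← Set.countable_coe_iff, ← Set.countable_univ_iff]
    convert this
    symm
    rw [Set.eq_univ_iff_forall]
    exact fun i => (hLD.measure_ball_pos _ (by positivity)).trans_le
      (measure_mono ball_subset_closedBall)
  · obtain ⟨y, hy, h⟩ := hcov x trivial
    refine ⟨y, hy, ?_⟩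
    have := h (mem_closedBall_self (by positivity))
    simpa [mul_div_cancel₀] using this

/-- Disjoint balls of radius `η / 5` centred in `ball x ρ` all lie in `ball x (|b| + η)`, and each
carries at least the fraction `1 / K` of its measure. Hence there are at most `K` of them. -/
theorem LocallyDoubling.exists_finset_cover (hLD : LocallyDoubling μ) [NeZero μ]
    [IsFiniteMeasure μ] {η : ℝ} (hη : 0 < η) (b : ℝ) :
    ∃ n : ℕ, ∀ (x : M) (ρ : ℝ), ρ ≤ b → ∃ F : Finset M, F.card ≤ n ∧ (F : Set M) ⊆ ball x ρ ∧
      ball x ρ ⊆ ⋃ y ∈ F, ball y η := by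
  obtain ⟨K, -, hK⟩ := hLD.exists_measure_ball_le (η := η / 5) (by positivity) (2 * |b| + η)
  refine ⟨⌊K⌋₊, fun x ρ hρ => ?_⟩
  -- The Vitali enlargement factor must exceed 3; with factor 4 the enlarged radius is `4η / 5 < η`.
  obtain ⟨u, hux, hu, hcov⟩ := Vitali.exists_disjoint_subfamily_covering_enlargement_closedBall
    (ball x ρ) id (fun _ => η / 5) (η / 5) (fun _ _ => le_rfl) 4 (by norm_num)
  have hb := hρ.trans (le_abs_self b)
  have hcard : ∀ G : Finset M, (G : Set M) ⊆ u → G.card ≤ ⌊K⌋₊ := by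
    intro G hG
    refine Nat.le_floor ?_
    have hm : μ (ball x (|b| + η)) ≠ 0 :=
      (hLD.measure_ball_pos x (by positivity)).ne'
    have h1 : ∑ y ∈ G, μ (closedBall y (η / 5)) ≤ μ (ball x (|b| + η)) := by
      simp only [id] at hu
      rw [← measure_biUnion_finset (hu.subset hG) (fun _ _ => measurableSet_closedBall)]
      refine measure_mono (Set.iUnion₂_subset fun y hy => ?_)
      refine closedBall_subset_ball' ?_
      have : dist y x < ρ := hux (hG hy)
      linarith
    have h2 : ∀ y ∈ G, μ (ball x (|b| + η)) ≤ K * μ (closedBall y (η / 5)) := by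
      intro y hy
      have : dist y x < ρ := hux (hG hy)
      calc μ (ball x (|b| + η)) ≤ μ (ball y (2 * |b| + η)) :=
            measure_mono (ball_subset_ball' (by rw [dist_comm]; linarith))
        _ ≤ K * μ (ball y (η / 5)) := hK y
        _ ≤ _ := by gcongr; exact ball_subset_closedBall
    have h3 : (G.card : ℝ≥0∞) * μ (ball x (|b| + η)) ≤ K * μ (ball x (|b| + η)) :=
      calc (G.card : ℝ≥0∞) * μ (ball x (|b| + η)) = ∑ y ∈ G, μ (ball x (|b| + η)) := by simp
        _ ≤ ∑ y ∈ G, K * μ (closedBall y (η / 5)) := Finset.sum_le_sum h2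
        _ ≤ _ := by rw [← Finset.mul_sum]; gcongr
    have h4 := (ENNReal.mul_le_mul_iff_left hm (measure_ne_top _ _)).1 h3
    exact_mod_cast h4
  have hfin : u.Finite := by
    by_contra h
    obtain ⟨G, hG, hc⟩ := Set.Infinite.exists_subset_card_eq h (⌊K⌋₊ + 1)
    have := hcard G hG
    omega
  refine ⟨hfin.toFinset, hcard _ (by simp), by simpa using hux, fun z hz => ?_⟩
  obtain ⟨y, hy, h⟩ := hcov z hz
  have := h (mem_closedBall_self (by positivity))
  simp only [Set.Finite.mem_toFinset, Set.mem_iUnion, mem_ball, exists_prop]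
  refine ⟨y, hy, ?_⟩
  simp only [id, mem_closedBall] at this
  linarith

end Doubling

/-! ### Chains of approximate midpoints. -/

/-- Each bisection shrinks distances by the factor `β` and doubles the number of links, so `k`
bisections with `β ^ k * L ≤ δ` suffice, at the cost `2 ^ k`. The pseudodistance is arbitrary and
may be infinite a priori, as the Hardy norm of a difference may be. -/
theorem ApproximateMidpoint.exists_chain_bound {M : Type*} [MetricSpace M] {R₀ β δ : ℝ}
    (hAM : ApproximateMidpoint M R₀ β) (hδ : R₀ ≤ δ) (hδ0 : 0 < δ) (L : ℝ) :
    ∃ n : ℕ, ∀ (d : M → M → ℝ≥0∞) (A : ℝ≥0∞), (∀ x y, d x y = d y x) →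
      (∀ x y z, d x z ≤ d x y + d y z) → (∀ x y, dist x y ≤ δ → d x y ≤ A) →
      ∀ x y, dist x y ≤ L → d x y ≤ n * A := by
  obtain ⟨-, hβ, hβ1, hmid⟩ := hAM
  have hβ0 : 0 < β := by linarith
  obtain ⟨k, hk⟩ := exists_pow_lt_of_lt_one (show 0 < δ / (|L| + 1) by positivity) hβ1
  refine ⟨2 ^ k, fun d A hsymm htri hA => ?_⟩
  have key : ∀ (k : ℕ) (x y : M), β ^ k * dist x y ≤ δ → d x y ≤ (2 ^ k : ℕ) * A := by
    intro k
    induction k with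
    | zero => intro x y h; simpa using hA x y (by simpa using h)
    | succ k ih =>
      intro x y h
      -- A pair within `R₀` may have no midpoint, but it is already a single link because `R₀ ≤ δ`.
      by_cases h0 : dist x y ≤ R₀
      · refine (hA x y (h0.trans hδ)).trans (le_mul_of_one_le_left zero_le ?_)
        exact_mod_cast Nat.one_le_two_pow
      · obtain ⟨z, hxz, hyz⟩ := hmid x y (not_le.1 h0)
        have hk : 0 < β ^ k := by positivity
        have h1 : β ^ k * dist x z ≤ δ := by
          refine le_trans ?_ h
          rw [pow_succ, mul_assoc]; gcongr
        have h2 : β ^ k * dist y z ≤ δ := by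
          refine le_trans ?_ h
          rw [pow_succ, mul_assoc]; gcongr
        calc d x y ≤ d x z + d z y := htri _ _ _
          _ = d x z + d y z := by rw [hsymm z y]
          _ ≤ (2 ^ k : ℕ) * A + (2 ^ k : ℕ) * A := add_le_add (ih _ _ h1) (ih _ _ h2)
          _ = _ := by rw [pow_succ]; push_cast; ring
  refine fun x y hxy => key k x y ?_
  rw [lt_div_iff₀ (by positivity)] at hk
  refine le_trans ?_ hk.le
  gcongr
  linarith [le_abs_self L]

theorem ApproximateMidpoint.lt_of_div_lt {M : Type*} [MetricSpace M] {R₀ β c : ℝ}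
    (hAM : ApproximateMidpoint M R₀ β) (hc : R₀ / (1 - β) < c) : 0 ≤ R₀ ∧ R₀ < c := by
  obtain ⟨h0, hβ, hβ1, -⟩ := hAM
  refine ⟨h0, lt_of_le_of_lt ?_ hc⟩
  rw [le_div_iff₀ (by linarith)]
  nlinarith

/-! ### Normalised norms on sets of comparable measure. -/

section Cond

theorem average_cond_eq (f : M → ℂ) (S : Set M) :
    ⨍ z in S, f z ∂μ = ∫ z, f z ∂(ProbabilityTheory.cond μ S) := by
  rw [average, ProbabilityTheory.cond, Measure.restrict_apply_univ]

variable {M : Type*} [MeasurableSpace M] {μ : Measure M}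

/-- Passing from the normalised `Lᵖ` norm on `E ⊆ S` inside `T` to that on `S`. -/
theorem eLpNorm_indicator_cond_le [IsFiniteMeasure μ]
    {E' : Type*} [NormedAddCommGroup E'] {S T E : Set M} {K : ℝ≥0}
    (hE : MeasurableSet E) (hES : E ⊆ S) (hK1 : 1 ≤ K) (hS0 : μ S ≠ 0)
    (hK : μ S ≤ K * μ T) {p : ℝ≥0∞} (hp : 1 ≤ p) (g : M → E') :
    eLpNorm (E.indicator g) p (ProbabilityTheory.cond μ T) ≤
      K * eLpNorm g p (ProbabilityTheory.cond μ S) := by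
  have hK0 : (K : ℝ≥0∞) ≠ 0 := by
    have : K ≠ 0 := by positivity
    exact_mod_cast this
  have hT0 : μ T ≠ 0 := by
    intro h
    rw [h, mul_zero] at hK
    exact hS0 (le_antisymm hK zero_le)
  rw [eLpNorm_indicator_eq_eLpNorm_restrict hE]
  -- The comparison takes place between measures, so a single argument serves all exponents.
  have hm : (ProbabilityTheory.cond μ T).restrict E ≤
      (K : ℝ≥0∞) • ProbabilityTheory.cond μ S := by
    rw [ProbabilityTheory.cond, ProbabilityTheory.cond, Measure.restrict_smul,
      Measure.restrict_restrict hE, smul_smul]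
    have h1 : (μ T)⁻¹ ≤ K * (μ S)⁻¹ := by
      rw [ENNReal.inv_le_iff_le_mul (fun _ => hT0) (fun h => absurd h (measure_ne_top _ _)),
        mul_comm (K : ℝ≥0∞), ← mul_assoc, mul_comm, ← mul_assoc]
      calc (1 : ℝ≥0∞) = μ S * (μ S)⁻¹ := (ENNReal.mul_inv_cancel hS0 (measure_ne_top _ _)).symm
        _ ≤ _ := by gcongr
    refine Measure.le_iff.2 fun s _ => ?_
    simp only [Measure.smul_apply, smul_eq_mul]
    gcongr
    exact Set.inter_subset_left.trans hES
  refine (eLpNorm_mono_measure g hm).trans ?_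
  rw [eLpNorm_smul_measure_of_ne_zero hK0, smul_eq_mul]
  gcongr
  have hK1' : (1 : ℝ≥0∞) ≤ K := by exact_mod_cast hK1
  -- Since `1 ≤ K`, the factor `K ^ (1 / p)` may be replaced by `K`, which does not depend on `p`;
  -- the case `p = ∞` is included.
  calc (K : ℝ≥0∞) ^ (1 / p).toReal ≤ (K : ℝ≥0∞) ^ (1 : ℝ) := by
        refine ENNReal.rpow_le_rpow_of_exponent_le hK1' ?_
        refine ENNReal.toReal_le_of_le_ofReal zero_le_one ?_
        simpa using hp
    _ = K := ENNReal.rpow_one _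

theorem eLpNorm_cond_le_of_subset [IsFiniteMeasure μ]
    {E' : Type*} [NormedAddCommGroup E'] {S T : Set M} {K : ℝ≥0}
    (hT : MeasurableSet T) (hTS : T ⊆ S) (hK1 : 1 ≤ K) (hS0 : μ S ≠ 0)
    (hK : μ S ≤ K * μ T) {p : ℝ≥0∞} (hp : 1 ≤ p) (g : M → E') :
    eLpNorm g p (ProbabilityTheory.cond μ T) ≤
      K * eLpNorm g p (ProbabilityTheory.cond μ S) := by
  refine le_trans (le_of_eq ?_) (eLpNorm_indicator_cond_le hT hTS hK1 hS0 hK hp g)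
  rw [eLpNorm_indicator_eq_eLpNorm_restrict hT]
  congr 1
  rw [ProbabilityTheory.cond, Measure.restrict_smul, Measure.restrict_restrict hT, Set.inter_self]

theorem enorm_average_sub_le [IsFiniteMeasure μ]
    {f : M → ℂ} (hf : Integrable f μ) {S : Set M} (hS0 : μ S ≠ 0)
    (α : ℂ) :
    ‖(⨍ z in S, f z ∂μ) - α‖ₑ ≤ eLpNorm (fun y => f y - α) 1 (ProbabilityTheory.cond μ S) := by
  have := ProbabilityTheory.cond_isProbabilityMeasure hS0
  have hf' : Integrable f (ProbabilityTheory.cond μ S) :=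
    hf.integrableOn.smul_measure (ENNReal.inv_ne_top.2 hS0)
  rw [average_cond_eq, eLpNorm_one_eq_lintegral_enorm]
  have : (∫ z, f z ∂(ProbabilityTheory.cond μ S)) - α =
      ∫ z, (f z - α) ∂(ProbabilityTheory.cond μ S) := by
    rw [integral_sub hf' (integrable_const _)]; simp
  rw [this]
  exact enorm_integral_le_lintegral_enorm _

/-- The average differs from `α` by at most the mean of `|f - α|`, so the average is, up to a factor
2, the best constant to subtract. -/
theorem eLpNorm_sub_average_le [IsFiniteMeasure μ]
    {f : M → ℂ} (hf : Integrable f μ) {S : Set M} (hS0 : μ S ≠ 0)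
    (α : ℂ) {p : ℝ≥0∞} (hp : 1 ≤ p) :
    eLpNorm (fun y => f y - ⨍ z in S, f z ∂μ) p (ProbabilityTheory.cond μ S) ≤
      2 * eLpNorm (fun y => f y - α) p (ProbabilityTheory.cond μ S) := by
  have := ProbabilityTheory.cond_isProbabilityMeasure hS0
  have hm : AEStronglyMeasurable f (ProbabilityTheory.cond μ S) :=
    hf.aestronglyMeasurable.mono_ac ProbabilityTheory.cond_absolutelyContinuous
  have hα : AEStronglyMeasurable (fun y => f y - α) (ProbabilityTheory.cond μ S) :=
    hm.sub aestronglyMeasurable_const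
  have h : (fun y => f y - ⨍ z in S, f z ∂μ) =
      (fun y => f y - α) - fun _ => (⨍ z in S, f z ∂μ) - α := by
    funext y; simp
  rw [h, two_mul]
  refine (eLpNorm_sub_le hα aestronglyMeasurable_const hp).trans ?_
  gcongr
  rw [eLpNorm_const _ (by positivity) (NeZero.ne _)]
  simp only [measure_univ, ENNReal.one_rpow, mul_one]
  exact (enorm_average_sub_le hf hS0 α).trans (eLpNorm_le_eLpNorm_of_exponent_le hp hα)

theorem eLpNorm_cond_le_sum_indicator {ι E' : Type*} [NormedAddCommGroup E'] {S : Set M}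
    {F : Finset ι} {B : ι → Set M} (hS : MeasurableSet S) (hB : ∀ i, MeasurableSet (B i))
    (hcov : S ⊆ ⋃ i ∈ F, B i) {p : ℝ≥0∞} (hp : 1 ≤ p) {g : M → E'}
    (hg : AEStronglyMeasurable g μ) :
    eLpNorm g p (ProbabilityTheory.cond μ S) ≤
      ∑ i ∈ F, eLpNorm ((B i).indicator g) p (ProbabilityTheory.cond μ S) := by
  have hg' : AEStronglyMeasurable g (ProbabilityTheory.cond μ S) :=
    hg.mono_ac ProbabilityTheory.cond_absolutelyContinuous
  -- The sets may overlap; with norms in place of values nothing cancels in the sum of indicators,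
  -- and it dominates `g` on `S`.
  calc eLpNorm g p (ProbabilityTheory.cond μ S)
      ≤ eLpNorm (∑ i ∈ F, (B i).indicator fun z => ‖g z‖) p (ProbabilityTheory.cond μ S) := by
        refine eLpNorm_mono_ae ?_
        filter_upwards [ProbabilityTheory.ae_cond_mem hS] with z hz
        obtain ⟨i, hi, hzi⟩ := Set.mem_iUnion₂.1 (hcov hz)
        rw [Finset.sum_apply]
        refine le_trans ?_ (le_abs_self _)
        refine le_trans (le_of_eq ?_) (Finset.single_le_sum (fun j _ => ?_) hi)
        · rw [Set.indicator_of_mem hzi]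
        · exact Set.indicator_nonneg (fun _ _ => norm_nonneg _) _
    _ ≤ ∑ i ∈ F, eLpNorm ((B i).indicator fun z => ‖g z‖) p (ProbabilityTheory.cond μ S) :=
        eLpNorm_sum_le (fun i _ => hg'.norm.indicator (hB i)) hp
    _ = _ := by
        refine Finset.sum_congr rfl fun i _ => ?_
        rw [eLpNorm_indicator_eq_eLpNorm_restrict (hB i),
          eLpNorm_indicator_eq_eLpNorm_restrict (hB i), eLpNorm_norm]

end Cond

/-! ### Change of scale for the oscillation seminorm. -/

section BMOScale

variable {M : Type*} [MetricSpace M] [MeasurableSpace M] {μ : Measure M}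

theorem oscNorm_mono_radius {b c : ℝ} (h : c ≤ b) (q : ℝ≥0∞) (f : M → ℂ) :
    oscNorm μ c q f ≤ oscNorm μ b q f :=
  iSup_mono fun _ => iSup_mono fun _ => iSup_mono' fun hρ => ⟨⟨hρ.1, hρ.2.trans h⟩, le_rfl⟩

theorem eLpNorm_sub_average_le_oscNorm {b ρ : ℝ} (hρ : 0 < ρ) (hb : ρ ≤ b) (q : ℝ≥0∞)
    (f : M → ℂ) (x : M) :
    eLpNorm (fun y => f y - ⨍ z in ball x ρ, f z ∂μ) q (ProbabilityTheory.cond μ (ball x ρ)) ≤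
      oscNorm μ b q f :=
  le_iSup_of_le x (le_iSup₂_of_le ρ ⟨hρ, hb⟩ le_rfl)

variable [IsFiniteMeasure μ] [NeZero μ]

theorem LocallyDoubling.oscNorm_mono_exponent (hLD : LocallyDoubling μ) (b : ℝ) {p q : ℝ≥0∞}
    (hpq : p ≤ q) {f : M → ℂ} (hf : Integrable f μ) : oscNorm μ b p f ≤ oscNorm μ b q f := by
  refine iSup_mono fun x => iSup_mono fun ρ => iSup_mono fun hρ => ?_
  have := ProbabilityTheory.cond_isProbabilityMeasure (hLD.measure_ball_pos x hρ.1).ne'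
  refine eLpNorm_le_eLpNorm_of_exponent_le hpq ?_
  exact (hf.aestronglyMeasurable.sub aestronglyMeasurable_const).mono_ac
    ProbabilityTheory.cond_absolutelyContinuous

/-- Averages of `f` over sets `T ⊆ B` that fill a fixed proportion of a ball `B`. -/
theorem enorm_average_sub_average_le (hLD : LocallyDoubling μ) {b ρ : ℝ} (hρ : 0 < ρ)
    (hb : ρ ≤ b) {f : M → ℂ} (hf : Integrable f μ) {x : M} {T : Set M} (hT : MeasurableSet T)
    (hTB : T ⊆ ball x ρ) {K : ℝ≥0} (hK1 : 1 ≤ K) (hK : μ (ball x ρ) ≤ K * μ T) :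
    ‖(⨍ z in T, f z ∂μ) - ⨍ z in ball x ρ, f z ∂μ‖ₑ ≤ K * oscNorm μ b 1 f := by
  have hB0 := (hLD.measure_ball_pos x hρ).ne'
  have hT0 : μ T ≠ 0 := by
    intro h
    rw [h, mul_zero] at hK
    exact hB0 (le_antisymm hK zero_le)
  refine (enorm_average_sub_le hf hT0 _).trans ?_
  refine (eLpNorm_cond_le_of_subset hT hTB hK1 hB0 hK le_rfl _).trans ?_
  gcongr
  exact eLpNorm_sub_average_le_oscNorm hρ hb 1 f x

/-- Only balls with `c ≤ ρ ≤ b` need work. Such a ball is covered by boundedly many `η`-balls; on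
each of them `f` is close to its own average, and a chain compares this average with the one over
`ball x η`. -/
theorem oscNorm_le_mul_oscNorm [OpensMeasurableSpace M] (hLD : LocallyDoubling μ) {R₀ β b c : ℝ}
    (hAM : ApproximateMidpoint M R₀ β) (hc : R₀ / (1 - β) < c) (hcb : c ≤ b) :
    ∃ C : ℝ≥0, 1 ≤ C ∧ ∀ (q : ℝ≥0∞) (f : M → ℂ), 1 ≤ q → Integrable f μ →
      oscNorm μ b q f ≤ C * oscNorm μ c q f := by
  obtain ⟨hR0, hRc⟩ := hAM.lt_of_div_lt hc
  -- Since `δ + η = c`, an `η`-ball whose centre is within `δ` of `x` lies in `ball x c`. Both `δ ≥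
  -- R₀` and `η > 0` follow from `R₀ < c`.
  obtain ⟨δ, hδ⟩ : ∃ δ, δ = (R₀ + c) / 2 := ⟨_, rfl⟩
  obtain ⟨η, hη⟩ : ∃ η, η = (c - R₀) / 2 := ⟨_, rfl⟩
  have hη0 : 0 < η := by linarith
  obtain ⟨K, hK1, hK⟩ := hLD.exists_measure_ball_le hη0 (b + c + δ + η)
  obtain ⟨m, hm⟩ := hAM.exists_chain_bound (δ := δ) (by linarith) (by linarith) b
  obtain ⟨n, hn⟩ := hLD.exists_finset_cover hη0 b
  -- The summand 1 serves `ρ ≤ c`. Otherwise 2 pays for subtracting the average over `ball x η`, `n`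
  -- counts the cover, the outer `K` changes the normalisation, and `m * (K + K)` bounds the drift
  -- of averages along a chain.
  refine ⟨1 + 2 * (n * (K * (1 + m * (K + K)))), le_self_add, fun q f hq hf => ?_⟩
  have hchain := hm (fun x y => ‖(⨍ z in ball x η, f z ∂μ) - ⨍ z in ball y η, f z ∂μ‖ₑ)
    ((K + K) * oscNorm μ c 1 f) (fun x y => by rw [← enorm_neg]; simp)
    (fun x y z => by
      refine le_trans (le_of_eq ?_) (enorm_add_le _ _)
      congr 1; ring)
    (fun x y hxy => by
      have h1 : ∀ w, dist w x ≤ δ →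
          ‖(⨍ z in ball w η, f z ∂μ) - ⨍ z in ball x c, f z ∂μ‖ₑ ≤ K * oscNorm μ c 1 f := by
        intro w hw
        refine enorm_average_sub_average_le hLD (by linarith) le_rfl hf measurableSet_ball
          (ball_subset_ball' (by linarith)) hK1 ((measure_mono ?_).trans (hK w))
        exact ball_subset_ball' (by rw [dist_comm]; linarith)
      rw [add_mul]
      refine le_trans (le_of_eq ?_) ((enorm_sub_le (E := ℂ)).trans
        (add_le_add (h1 x (by simp; linarith)) (h1 y (by rwa [dist_comm]))))
      congr 1; ring)
  refine iSup_le fun x => iSup₂_le fun ρ hρ => ?_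
  push_cast
  rw [add_mul, one_mul]
  rcases le_total ρ c with hρc | hcρ
  · exact (eLpNorm_sub_average_le_oscNorm hρ.1 hρc q f x).trans le_self_add
  refine le_trans ?_ le_add_self
  have hB0 := (hLD.measure_ball_pos x hρ.1).ne'
  refine (eLpNorm_sub_average_le hf hB0 (⨍ z in ball x η, f z ∂μ) hq).trans ?_
  rw [mul_assoc]
  gcongr
  obtain ⟨F, hFn, hFx, hFcov⟩ := hn x ρ hρ.2
  refine (eLpNorm_cond_le_sum_indicator measurableSet_ball (fun _ => measurableSet_ball) hFcov hq
    (hf.aestronglyMeasurable.sub aestronglyMeasurable_const)).trans ?_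
  refine (Finset.sum_le_card_nsmul _ _ (K * (1 + m * (K + K)) * oscNorm μ c q f)
    fun y hy => ?_).trans ?_
  · have hyx : dist y x < ρ := hFx hy
    have hy0 := (hLD.measure_ball_pos y hη0).ne'
    have := ProbabilityTheory.cond_isProbabilityMeasure hy0
    have hKy : μ (ball y η) ≤ K * μ (ball x ρ) :=
      calc μ (ball y η) ≤ μ (ball x (b + c + δ + η)) :=
            measure_mono (ball_subset_ball' (by linarith [hρ.2]))
        _ ≤ K * μ (ball x η) := hK x
        _ ≤ _ := by gcongr; linarith
    refine (eLpNorm_indicator_cond_le measurableSet_ball subset_rfl hK1 hy0 hKy hq _).trans ?_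
    rw [mul_assoc]
    gcongr
    have hsplit : (fun z => f z - ⨍ z in ball x η, f z ∂μ) =
        (fun z => f z - ⨍ z in ball y η, f z ∂μ) +
          fun _ => (⨍ z in ball y η, f z ∂μ) - ⨍ z in ball x η, f z ∂μ := by
      funext z; simp
    change eLpNorm (fun z => f z - ⨍ z in ball x η, f z ∂μ) q _ ≤ _
    rw [hsplit]
    refine (eLpNorm_add_le ?_ aestronglyMeasurable_const hq).trans ?_
    · exact (hf.aestronglyMeasurable.sub aestronglyMeasurable_const).mono_ac
        ProbabilityTheory.cond_absolutelyContinuous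
    · rw [add_mul, one_mul]
      refine add_le_add (eLpNorm_sub_average_le_oscNorm hη0 (by linarith) q f y) ?_
      rw [eLpNorm_const _ (by positivity) (NeZero.ne _)]
      simp only [measure_univ, ENNReal.one_rpow, mul_one]
      refine (hchain y x (by linarith [hρ.2])).trans ?_
      rw [mul_assoc]
      gcongr
      exact hLD.oscNorm_mono_exponent c hq hf
  · rw [nsmul_eq_mul, mul_assoc (n : ℝ≥0∞)]
    gcongr

end BMOScale

/-! ### Completeness of BMO. -/

section BMOComplete

variable {M : Type*} [MetricSpace M] [MeasurableSpace M] {μ : Measure M}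

/-- Lower semicontinuity: averages over a fixed ball converge under `L¹` convergence, and Fatou's
lemma applies along an almost everywhere convergent subsequence. -/
theorem oscNorm_le_of_tendsto [IsFiniteMeasure μ] {b : ℝ} {q : ℝ≥0∞} {f : ℕ → Lp ℂ 1 μ}
    {g : Lp ℂ 1 μ} (hfg : Filter.Tendsto f Filter.atTop (nhds g)) {A : ℝ≥0∞}
    (hA : ∀ᶠ n in Filter.atTop, oscNorm μ b q (f n) ≤ A) : oscNorm μ b q g ≤ A := by
  obtain ⟨ns, hns, hae⟩ := (tendstoInMeasure_of_tendsto_Lp hfg).exists_seq_tendsto_ae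
  refine iSup_le fun x => iSup₂_le fun ρ hρ => ?_
  have havg : Filter.Tendsto (fun n => ⨍ z in ball x ρ, f (ns n) z ∂μ) Filter.atTop
      (nhds (⨍ z in ball x ρ, g z ∂μ)) := by
    simp only [setAverage_eq]
    exact ((continuous_setIntegral (ball x ρ)).tendsto g |>.comp
      (hfg.comp hns.tendsto_atTop)).const_smul _
  refine (Lp.eLpNorm_lim_le_liminf_eLpNorm
    (f := fun n y => f (ns n) y - ⨍ z in ball x ρ, f (ns n) z ∂μ) (fun n => ?_) _ ?_).trans ?_
  · exact ((Lp.aestronglyMeasurable _).sub aestronglyMeasurable_const).mono_ac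
      ProbabilityTheory.cond_absolutelyContinuous
  · filter_upwards [ProbabilityTheory.cond_absolutelyContinuous.ae_le hae] with y hy
    exact hy.sub havg
  · refine Filter.liminf_le_of_frequently_le' (Filter.Eventually.frequently ?_)
    filter_upwards [hns.tendsto_atTop.eventually hA] with n hn
    exact (eLpNorm_sub_average_le_oscNorm hρ.1 hρ.2 q _ x).trans hn

theorem BMOSpace.oscNorm_lt_top {b : ℝ} {q : ℝ≥0∞} [Fact (1 ≤ q)] (f : BMOSpace μ b q) :
    oscNorm μ b q f.toL1 < ∞ :=
  f.2

theorem BMOSpace.exists_toL1_eq {b : ℝ} {q : ℝ≥0∞} [Fact (1 ≤ q)] {g : Lp ℂ 1 μ}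
    (hg : oscNorm μ b q g < ∞) : ∃ f : BMOSpace μ b q, f.toL1 = g :=
  ⟨⟨g, hg⟩, rfl⟩

theorem completeSpace_BMOSpace [IsFiniteMeasure μ] (b : ℝ) (q : ℝ≥0∞) [Fact (1 ≤ q)] :
    CompleteSpace (BMOSpace μ b q) := by
  refine Metric.complete_of_cauchySeq_tendsto fun u hu => ?_
  have hL1 : ∀ f : BMOSpace μ b q, ‖f.toL1‖ ≤ ‖f‖ := fun f => by
    rw [BMOSpace.norm_def]; linarith [ENNReal.toReal_nonneg (a := oscNorm μ b q f.toL1)]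
  have hosc : ∀ f : BMOSpace μ b q, oscNorm μ b q f.toL1 ≤ ENNReal.ofReal ‖f‖ := fun f => by
    rw [ENNReal.le_ofReal_iff_toReal_le f.oscNorm_lt_top.ne (norm_nonneg _), BMOSpace.norm_def]
    linarith [norm_nonneg f.toL1]
  have hu1 : CauchySeq fun n => (u n).toL1 := by
    rw [Metric.cauchySeq_iff] at hu ⊢
    intro ε hε
    obtain ⟨N, hN⟩ := hu ε hε
    refine ⟨N, fun m hm n hn => lt_of_le_of_lt ?_ (hN m hm n hn)⟩
    rw [dist_eq_norm, dist_eq_norm, ← map_sub]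
    exact hL1 _
  obtain ⟨g, hg⟩ := cauchySeq_tendsto_of_complete hu1
  -- With `n` fixed, `u n - u m` tends to `u n - g` in `L¹`, so semicontinuity carries the Cauchy
  -- bound to the limit in `m`.
  have hlim : ∀ ε > 0, ∃ N, ∀ n ≥ N, oscNorm μ b q ((u n).toL1 - g : Lp ℂ 1 μ) ≤
      ENNReal.ofReal ε := by
    intro ε hε
    obtain ⟨N, hN⟩ := Metric.cauchySeq_iff.1 hu ε hε
    refine ⟨N, fun n hn => oscNorm_le_of_tendsto (hg.const_sub (u n).toL1) ?_⟩
    filter_upwards [Filter.eventually_ge_atTop N] with m hm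
    rw [← map_sub]
    refine (hosc _).trans (ENNReal.ofReal_le_ofReal ?_)
    rw [← dist_eq_norm]
    exact (hN n hn m hm).le
  have hmem : g ∈ bmoSubmodule μ b q := by
    obtain ⟨N, hN⟩ := hlim 1 one_pos
    have h1 : (u N).toL1 - g ∈ bmoSubmodule μ b q := (hN N le_rfl).trans_lt ENNReal.ofReal_lt_top
    have := (bmoSubmodule μ b q).sub_mem (u N).2 h1
    rwa [show ((u N).1 : Lp ℂ 1 μ) - ((u N).toL1 - g) = g from sub_sub_cancel _ _] at this
  obtain ⟨G, hG⟩ := BMOSpace.exists_toL1_eq hmem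
  refine ⟨G, ?_⟩
  rw [Metric.tendsto_atTop]
  intro ε hε
  obtain ⟨N, hN⟩ := hlim (ε / 4) (by positivity)
  obtain ⟨N', hN'⟩ := Metric.tendsto_atTop.1 hg (ε / 2) (by positivity)
  refine ⟨max N N', fun n hn => ?_⟩
  rw [dist_eq_norm, BMOSpace.norm_def, map_sub, hG]
  have h1 := hN' n ((le_max_right _ _).trans hn)
  have h2 := ENNReal.toReal_le_of_le_ofReal (by positivity) (hN n ((le_max_left _ _).trans hn))
  rw [dist_eq_norm] at h1
  refine lt_of_lt_of_le (add_lt_add_of_lt_of_le h1 h2) ?_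
  linarith

end BMOComplete

/-! ### Stopping-time balls and geometric decay of level sets. -/

section JohnNirenberg

theorem eLpNorm_one_cond_le_iff {M : Type*} [MeasurableSpace M] {μ : Measure M}
    [IsFiniteMeasure μ] {S : Set M} (hS0 : μ S ≠ 0) {g : M → ℂ} {A : ℝ≥0∞} :
    eLpNorm g 1 (ProbabilityTheory.cond μ S) ≤ A ↔ ∫⁻ y in S, ‖g y‖ₑ ∂μ ≤ A * μ S := by
  rw [ProbabilityTheory.cond, eLpNorm_one_smul_measure, eLpNorm_one_eq_lintegral_enorm, mul_comm,
    ← div_eq_mul_inv, ENNReal.div_le_iff hS0 (measure_ne_top _ _)]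

variable {M : Type*} [MetricSpace M] [MeasurableSpace M] {μ : Measure M}
  [IsFiniteMeasure μ]

variable [BorelSpace M] [NeZero μ]

/-- A Calderón-Zygmund type stopping-time selection of balls. -/
theorem LocallyDoubling.exists_stopping_balls (hLD : LocallyDoubling μ) {b : ℝ} (hb : 0 < b) :
    ∃ A : ℝ≥0, 1 ≤ A ∧ ∀ (f : M → ℂ) (N : ℝ≥0), Integrable f μ → 0 < N →
      oscNorm μ (2 * b) 1 f ≤ N → ∀ (x₀ : M) (ρ : ℝ), 0 < ρ → ρ ≤ b →
      ∃ (u : Set M) (t : M → ℝ), u.Countable ∧ (∀ y ∈ u, 0 < t y ∧ t y ≤ b) ∧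
        ∑' y : u, μ (ball y (t y)) ≤ 2⁻¹ * μ (ball x₀ ρ) ∧
        (∀ y ∈ u, ‖(⨍ z in ball y (t y), f z ∂μ) - ⨍ z in ball x₀ ρ, f z ∂μ‖ₑ ≤ A * N) ∧
        ∀ᵐ x ∂μ, x ∈ ball x₀ ρ → x ∉ ⋃ y ∈ u, ball y (t y) →
          ‖f x - ⨍ z in ball x₀ ρ, f z ∂μ‖ₑ ≤ A * N := by
  -- The factor `2 ^ 5 = 32` exceeds every ratio of radii met below; the largest is `3ρ` to `ρ / 8`.
  obtain ⟨D, hD1, hD⟩ := hLD.exists_measure_ball_pow_mul_le (b := 2 * b) (by positivity) 5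
  have hsc := hLD.secondCountableTopology
  have hdb := hLD.isUnifLocDoublingMeasure
  -- Here `2 * D ^ 2` is the stopping level `lam`; one `D` bounds the distance from `fB` to `α`, the
  -- other the passage from the last good ball to the selected ball.
  refine ⟨D + D + 2 * D ^ 2, by
    rw [add_assoc]; exact le_add_right hD1, fun f N hf hN hfN x₀ ρ hρ hρb => ?_⟩
  -- Balls of radius at most `ρ` centred in `ball x₀ ρ` may stick out of it but stay in the doubled
  -- ball, whose average is therefore the reference value.
  set α : ℂ := ⨍ z in ball x₀ (2 * ρ), f z ∂μ with hα
  set fB : ℂ := ⨍ z in ball x₀ ρ, f z ∂μ with hfB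
  have hρ2 : 0 < 2 * ρ := by positivity
  have hB0 := (hLD.measure_ball_pos x₀ hρ).ne'
  have hBs0 := (hLD.measure_ball_pos x₀ hρ2).ne'
  have hD' : ∀ (x : M) (s t : ℝ), 0 < t → t ≤ 2 * b → s ≤ 32 * t →
      μ (ball x s) ≤ D * μ (ball x t) := fun x s t ht htb hst =>
    (measure_mono (ball_subset_ball (by linarith))).trans (hD x t ht htb)
  have hint : ∫⁻ y in ball x₀ (2 * ρ), ‖f y - α‖ₑ ∂μ ≤ N * μ (ball x₀ (2 * ρ)) := by
    rw [← eLpNorm_one_cond_le_iff (g := fun y => f y - α) hBs0]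
    exact (eLpNorm_sub_average_le_oscNorm hρ2 (by linarith) 1 f x₀).trans hfN
  have hαfB : ‖fB - α‖ₑ ≤ D * N := by
    refine (enorm_average_sub_average_le hLD (b := 2 * b) hρ2 (by linarith) hf measurableSet_ball
      (ball_subset_ball (by linarith)) hD1 (hD' _ _ _ hρ (by linarith) (by linarith))).trans ?_
    gcongr
  set s : ℕ → ℝ := fun j => ρ / 2 ^ j with hs
  have hs0 : ∀ j, 0 < s j := fun j => by positivity
  have hcB0 : ∀ (x : M) (r : ℝ), 0 < r → μ (closedBall x r) ≠ 0 := fun x r hr =>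
    ((hLD.measure_ball_pos x hr).trans_le (measure_mono ball_subset_closedBall)).ne'
  -- The level is at least `D`, so that large radii are good, and is `2 * D ^ 2` so that the
  -- selected balls have at most half the measure of `ball x₀ ρ`.
  set lam : ℝ≥0 := 2 * D ^ 2 with hlam
  set bad : M → ℕ → Prop := fun x j => lam * N * μ (closedBall x (s j)) <
    ∫⁻ y in closedBall x (s j), ‖f y - α‖ₑ ∂μ with hbad
  have havg : ∀ (x : M) (j : ℕ), ¬ bad x j →
      ‖(⨍ z in closedBall x (s j), f z ∂μ) - α‖ₑ ≤ lam * N := by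
    intro x j h
    refine (enorm_average_sub_le hf (hcB0 x _ (hs0 j)) α).trans ?_
    exact (eLpNorm_one_cond_le_iff (hcB0 x _ (hs0 j))).2 (not_lt.1 h)
  have hsub : ∀ x ∈ ball x₀ ρ, ∀ r ≤ ρ, closedBall x r ⊆ ball x₀ (2 * ρ) := by
    intro x hx r hr
    have : dist x x₀ < ρ := hx
    exact closedBall_subset_ball' (by linarith)
  -- Four good generations force the stopping radius down to `ρ / 16`, so the selected balls, eight
  -- times larger, still have radius at most `b`.
  have hgood : ∀ x ∈ ball x₀ ρ, ∀ j ≤ 3, ¬ bad x j := by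
    intro x hx j hj
    have hx' : dist x x₀ < ρ := hx
    have hj1 : s j ≤ ρ := div_le_self hρ.le (one_le_pow₀ one_le_two)
    have hj8 : ρ ≤ 8 * s j := by
      have : (2 : ℝ) ^ j ≤ 2 ^ 3 := pow_le_pow_right₀ one_le_two hj
      simp only [hs]
      rw [mul_div_assoc', le_div_iff₀ (by positivity)]
      nlinarith
    rw [hbad, not_lt]
    calc ∫⁻ y in closedBall x (s j), ‖f y - α‖ₑ ∂μ
        ≤ ∫⁻ y in ball x₀ (2 * ρ), ‖f y - α‖ₑ ∂μ := lintegral_mono_set (hsub x hx _ hj1)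
      _ ≤ N * μ (ball x₀ (2 * ρ)) := hint
      _ ≤ N * (D * μ (closedBall x (s j))) := by
          gcongr
          calc μ (ball x₀ (2 * ρ)) ≤ μ (ball x (3 * ρ)) :=
                measure_mono (ball_subset_ball' (by rw [dist_comm]; linarith))
            _ ≤ D * μ (ball x (s j)) := hD' _ _ _ (hs0 j) (by linarith) (by linarith)
            _ ≤ _ := by gcongr; exact ball_subset_closedBall
      _ = D * N * μ (closedBall x (s j)) := by ring
      _ ≤ lam * N * μ (closedBall x (s j)) := by
          gcongr
          rw [hlam]
          nlinarith [hD1]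
  classical
  set S : Set M := {x | x ∈ ball x₀ ρ ∧ ∃ j, bad x j} with hS
  -- `J x` is the first bad generation; the value 0 outside `S` plays no role.
  set J : M → ℕ := fun x => if h : ∃ j, bad x j then Nat.find h else 0 with hJ
  have hJS : ∀ x ∈ S, bad x (J x) ∧ 4 ≤ J x ∧ ¬ bad x (J x - 1) := by
    rintro x ⟨hx, h⟩
    have hJx : J x = Nat.find h := by rw [hJ]; simp only [dif_pos h]
    have h1 : bad x (J x) := by rw [hJx]; exact Nat.find_spec h
    have h4 : 4 ≤ J x := by
      by_contra hlt
      exact hgood x hx _ (by omega) h1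
    refine ⟨h1, h4, ?_⟩
    have hlt : J x - 1 < Nat.find h := by omega
    exact Nat.find_min h hlt
  have ht16 : ∀ x ∈ S, s (J x) ≤ ρ / 16 := by
    intro x hx
    have : (2 : ℝ) ^ 4 ≤ 2 ^ J x := pow_le_pow_right₀ one_le_two (hJS x hx).2.1
    simp only [hs]
    gcongr
    linarith
  have ht2 : ∀ x ∈ S, s (J x - 1) = 2 * s (J x) := by
    intro x hx
    obtain ⟨m, hm⟩ : ∃ m, J x = m + 1 := ⟨J x - 1, by have := (hJS x hx).2.1; omega⟩
    simp only [hs, hm, Nat.add_sub_cancel, pow_succ]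
    field_simp
  obtain ⟨u, huS, hu, hcov⟩ := Vitali.exists_disjoint_subfamily_covering_enlargement_closedBall
    -- The Vitali factor 5 leaves room to replace enlarged closed balls by open balls with factor 8.
    S id (fun x => s (J x)) ρ (fun x hx => (ht16 x hx).trans (by linarith)) 5 (by norm_num)
  simp only [id] at hu hcov
  have huc : u.Countable := by
    refine hu.countable_of_nonempty_interior fun x _ => ?_
    exact ⟨x, ball_subset_interior_closedBall (mem_ball_self (hs0 _))⟩
  have hcovS : ∀ x ∈ S, x ∈ ⋃ y ∈ u, ball y (8 * s (J y)) := by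
    intro x hx
    obtain ⟨y, hy, h⟩ := hcov x hx
    refine Set.mem_iUnion₂.2 ⟨y, hy, ?_⟩
    refine closedBall_subset_ball ?_ (h (mem_closedBall_self (hs0 _).le))
    linarith [hs0 (J y)]
  refine ⟨u, fun y => 8 * s (J y), huc, fun y hy => ⟨by linarith [hs0 (J y)], by
    linarith [ht16 y (huS hy)]⟩, ?_, ?_, ?_⟩
  -- Badness bounds each measure by an integral over a closed ball; these are disjoint and contained
  -- in the doubled ball, so the integrals add up to at most the total oscillation there.
  · have h1 : ∀ y : u, lam * N * μ (ball (y : M) (8 * s (J y))) ≤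
        D * ∫⁻ z in closedBall (y : M) (s (J y)), ‖f z - α‖ₑ ∂μ := by
      intro y
      calc lam * N * μ (ball (y : M) (8 * s (J y)))
          ≤ lam * N * (D * μ (closedBall (y : M) (s (J y)))) := by
            gcongr
            refine (hD' _ _ (s (J y)) (hs0 _) ?_ ?_).trans ?_
            · linarith [ht16 y (huS y.2)]
            · linarith [hs0 (J y)]
            · gcongr; exact ball_subset_closedBall
        _ = D * (lam * N * μ (closedBall (y : M) (s (J y)))) := by ring
        _ ≤ _ := by gcongr; exact (hJS y (huS y.2)).1.le
    have h2 : ∑' y : u, ∫⁻ z in closedBall (y : M) (s (J y)), ‖f z - α‖ₑ ∂μ ≤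
        N * (D * μ (ball x₀ ρ)) := by
      rw [← lintegral_biUnion huc (fun _ _ => measurableSet_closedBall) hu]
      calc _ ≤ ∫⁻ y in ball x₀ (2 * ρ), ‖f y - α‖ₑ ∂μ :=
            lintegral_mono_set (Set.iUnion₂_subset fun y hy =>
              hsub y (huS hy).1 _ ((ht16 y (huS hy)).trans (by linarith)))
        _ ≤ N * μ (ball x₀ (2 * ρ)) := hint
        _ ≤ _ := by gcongr; exact hD' _ _ _ hρ (by linarith) (by linarith)
    have h3 : lam * N * ∑' y : u, μ (ball (y : M) (8 * s (J y))) ≤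
        lam * N * (2⁻¹ * μ (ball x₀ ρ)) := by
      rw [← ENNReal.tsum_mul_left]
      refine (ENNReal.tsum_le_tsum h1).trans ?_
      rw [ENNReal.tsum_mul_left]
      refine (mul_le_mul_right h2 _).trans (le_of_eq ?_)
      rw [hlam]
      push_cast
      calc (D : ℝ≥0∞) * (N * (D * μ (ball x₀ ρ)))
          = (2 * 2⁻¹) * (D ^ 2 * N * μ (ball x₀ ρ)) := by
            rw [ENNReal.mul_inv_cancel two_ne_zero ENNReal.ofNat_ne_top]; ring
        _ = _ := by ring
    have hne : (lam * N : ℝ≥0∞) ≠ 0 := by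
      have : lam * N ≠ 0 := by positivity
      exact_mod_cast this
    exact (ENNReal.mul_le_mul_iff_right hne (by finiteness)).1 h3
  · intro y hy
    have hyS := huS hy
    -- By minimality of `J y` the previous generation is good, so its average is close to `α` and
    -- serves as the intermediate value.
    have h1 : ‖(⨍ z in closedBall y (s (J y - 1)), f z ∂μ) -
        ⨍ z in ball y (8 * s (J y)), f z ∂μ‖ₑ ≤ D * N := by
      rw [ht2 y hyS]
      have h0 := hs0 (J y)
      refine (enorm_average_sub_average_le hLD (b := 2 * b) (by positivity) ?_ hf
        measurableSet_closedBall (closedBall_subset_ball (by linarith)) hD1 ?_).trans ?_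
      · linarith [ht16 y hyS]
      · refine (hD' _ _ (s (J y)) h0 ?_ (by linarith)).trans ?_
        · linarith [ht16 y hyS]
        · gcongr
          exact ball_subset_closedBall.trans (closedBall_subset_closedBall (by linarith))
      · gcongr
    have h2 := havg y _ (hJS y hyS).2.2
    have heq : (⨍ z in ball y (8 * s (J y)), f z ∂μ) - fB =
        (((⨍ z in closedBall y (s (J y - 1)), f z ∂μ) - α) -
          ((⨍ z in closedBall y (s (J y - 1)), f z ∂μ) -
            ⨍ z in ball y (8 * s (J y)), f z ∂μ)) - (fB - α) := by ring
    rw [heq]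
    refine (enorm_sub_le.trans (add_le_add (enorm_sub_le.trans (add_le_add h2 h1)) hαfB)).trans
      (le_of_eq ?_)
    push_cast
    ring
  -- Outside the selected balls no generation is bad, so all averages around `x` are within `lam *
  -- N` of `α`, and at almost every point they converge to `f x`.
  · filter_upwards [IsUnifLocDoublingMeasure.ae_tendsto_average μ hf.locallyIntegrable 1]
      with x hx hxB hxu
    have hxS : ∀ j, ¬ bad x j := fun j hj => hxu (hcovS x ⟨hxB, j, hj⟩)
    have hslim : Filter.Tendsto s Filter.atTop (nhdsWithin 0 (Set.Ioi 0)) := by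
      refine tendsto_nhdsWithin_iff.2 ⟨?_, Filter.Eventually.of_forall hs0⟩
      simp only [hs, div_eq_mul_inv, ← inv_pow]
      simpa using (tendsto_pow_atTop_nhds_zero_of_lt_one (r := (2 : ℝ)⁻¹) (by norm_num)
        (by norm_num)).const_mul ρ
    have hlim := hx (fun _ => x) s hslim (Filter.Eventually.of_forall fun j =>
      mem_closedBall_self (by linarith [hs0 j]))
    have hle : ‖f x - α‖ₑ ≤ lam * N :=
      le_of_tendsto ((hlim.sub_const α).enorm)
        (Filter.Eventually.of_forall fun j => havg x j (hxS j))
    have heq : f x - fB = (f x - α) - (fB - α) := by ring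
    rw [heq]
    refine (enorm_sub_le.trans (add_le_add hle hαfB)).trans ?_
    push_cast
    rw [← add_mul]
    gcongr ?_ * _
    rw [add_comm]
    gcongr
    exact le_add_self

/-- Induction on `k` over all balls at once. A deviation above `(k + 1) * A * N` occurs, up to a
null set, only inside a selected ball; the average there has moved by at most `A * N`, so a
deviation above `k * A * N` remains, while the measure available has been halved. -/
theorem LocallyDoubling.exists_measure_lt_le_half_pow (hLD : LocallyDoubling μ) {b : ℝ}
    (hb : 0 < b) : ∃ A : ℝ≥0, 1 ≤ A ∧ ∀ (f : M → ℂ) (N : ℝ≥0), Integrable f μ → 0 < N →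
      oscNorm μ (2 * b) 1 f ≤ N → ∀ (k : ℕ) (x : M) (ρ : ℝ), 0 < ρ → ρ ≤ b →
      μ {y ∈ ball x ρ | (k * (A * N) : ℝ≥0∞) < ‖f y - ⨍ z in ball x ρ, f z ∂μ‖ₑ} ≤
        2⁻¹ ^ k * μ (ball x ρ) := by
  obtain ⟨A, hA1, hA⟩ := hLD.exists_stopping_balls hb
  refine ⟨A, hA1, fun f N hf hN hfN k => ?_⟩
  induction k with
  | zero =>
    intro x ρ _ _
    rw [pow_zero, one_mul]
    exact measure_mono (Set.sep_subset _ _)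
  | succ k ih =>
    intro x ρ hρ hρb
    obtain ⟨u, t, hu, ht, hsum, havg, hae⟩ := hA f N hf hN hfN x ρ hρ hρb
    have hsub : ({y ∈ ball x ρ | (((k + 1 : ℕ) : ℝ≥0∞) * (A * N)) <
        ‖f y - ⨍ z in ball x ρ, f z ∂μ‖ₑ} : Set M) ≤ᵐ[μ]
        (⋃ i ∈ u, {y ∈ ball i (t i) | (k * (A * N) : ℝ≥0∞) <
          ‖f y - ⨍ z in ball i (t i), f z ∂μ‖ₑ} : Set M) := by
      filter_upwards [hae] with y hy
      rintro ⟨hyB, hlt⟩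
      have hlt' : (k : ℝ≥0∞) * (A * N) + A * N < ‖f y - ⨍ z in ball x ρ, f z ∂μ‖ₑ := by
        refine lt_of_le_of_lt (le_of_eq ?_) hlt
        push_cast; ring
      have hyu : y ∈ ⋃ i ∈ u, ball i (t i) := by
        by_contra h
        exact absurd (hlt'.trans_le (hy hyB h)) (not_lt.2 le_add_self)
      obtain ⟨i, hi, hyi⟩ := Set.mem_iUnion₂.1 hyu
      refine Set.mem_iUnion₂.2 ⟨i, hi, hyi, ?_⟩
      have h1 : ‖f y - ⨍ z in ball x ρ, f z ∂μ‖ₑ ≤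
          ‖f y - ⨍ z in ball i (t i), f z ∂μ‖ₑ + A * N := by
        refine le_trans (le_of_eq ?_) ((enorm_add_le _ _).trans (add_le_add_right (havg i hi) _))
        congr 1; ring
      exact lt_of_add_lt_add_right (hlt'.trans_le h1)
    refine (measure_mono_ae hsub).trans ((measure_biUnion_le μ hu _).trans ?_)
    calc ∑' i : u, μ {y ∈ ball (i : M) (t i) | (k * (A * N) : ℝ≥0∞) <
          ‖f y - ⨍ z in ball (i : M) (t i), f z ∂μ‖ₑ}
        ≤ ∑' i : u, 2⁻¹ ^ k * μ (ball (i : M) (t i)) :=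
          ENNReal.tsum_le_tsum fun i => ih i (t i) (ht i i.2).1 (ht i i.2).2
      _ = 2⁻¹ ^ k * ∑' i : u, μ (ball (i : M) (t i)) := ENNReal.tsum_mul_left
      _ ≤ 2⁻¹ ^ k * (2⁻¹ * μ (ball x ρ)) := by gcongr
      _ = _ := by rw [pow_succ, mul_assoc]

end JohnNirenberg

/-- A discrete layer-cake bound. For `g > 0` the single term with `m * a < g ≤ (m + 1) * a` already
dominates. -/
theorem exists_enorm_pow_le_tsum (n : ℕ) {a : ℝ≥0} (ha : 0 < a) (g : ℝ≥0) :
    (g : ℝ≥0∞) ^ (n + 1) ≤ ∑' k : ℕ, if (k * a : ℝ≥0∞) < g then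
      (((k + 1 : ℕ) : ℝ≥0∞) * a) ^ (n + 1) else 0 := by
  rcases eq_or_ne g 0 with rfl | hg
  · simp
  have hg0 : 0 < g := pos_iff_ne_zero.2 hg
  obtain ⟨m, hm⟩ : ∃ m, ⌈g / a⌉₊ = m + 1 :=
    Nat.exists_eq_succ_of_ne_zero (Nat.ceil_pos.2 (by positivity)).ne'
  refine le_trans ?_ (ENNReal.le_tsum m)
  rw [if_pos]
  · gcongr
    have := Nat.le_ceil (g / a)
    rw [hm, div_le_iff₀ ha] at this
    exact_mod_cast this
  · have : m < ⌈g / a⌉₊ := by omega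
    rw [Nat.lt_ceil, lt_div_iff₀ ha] at this
    exact_mod_cast this

/-! ### The John-Nirenberg inequality and equivalence of exponents. -/

section JohnNirenbergConsequences

variable {M : Type*} [MetricSpace M] [MeasurableSpace M] {μ : Measure M}

theorem ae_eq_average_of_oscNorm_eq_zero {b : ℝ}
    {f : M → ℂ} (hf : Integrable f μ) (h0 : oscNorm μ b 1 f = 0) {x : M} {ρ : ℝ} (hρ : 0 < ρ)
    (hρb : ρ ≤ b) :
    (fun y => f y - ⨍ z in ball x ρ, f z ∂μ) =ᵐ[ProbabilityTheory.cond μ (ball x ρ)] 0 := by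
  have h := eLpNorm_sub_average_le_oscNorm (μ := μ) hρ hρb 1 f x
  rw [h0, nonpos_iff_eq_zero] at h
  refine (eLpNorm_eq_zero_iff ?_ one_ne_zero).1 h
  exact (hf.aestronglyMeasurable.sub aestronglyMeasurable_const).mono_ac
    ProbabilityTheory.cond_absolutelyContinuous

variable [IsFiniteMeasure μ] [NeZero μ] [BorelSpace M]

/-- The John-Nirenberg inequality in geometric form. -/
theorem LocallyDoubling.exists_measure_lt_le_half_pow_oscNorm (hLD : LocallyDoubling μ)
    {R₀ β b : ℝ} (hAM : ApproximateMidpoint M R₀ β) (hb : R₀ / (1 - β) < b) :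
    ∃ A : ℝ≥0, 1 ≤ A ∧ ∀ (f : M → ℂ) (N : ℝ≥0), Integrable f μ → 0 < N →
      oscNorm μ b 1 f = N → ∀ (k : ℕ) (x : M) (ρ : ℝ), 0 < ρ → ρ ≤ b →
      μ {y ∈ ball x ρ | (k * (A * N) : ℝ≥0∞) < ‖f y - ⨍ z in ball x ρ, f z ∂μ‖ₑ} ≤
        2⁻¹ ^ k * μ (ball x ρ) := by
  have hb0 : 0 < b := by
    obtain ⟨h0, h1⟩ := hAM.lt_of_div_lt hb
    linarith
  obtain ⟨A, hA1, hA⟩ := hLD.exists_measure_lt_le_half_pow hb0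
  -- The oscillation at scale `2b` required by the stopping argument is brought back to scale `b`;
  -- the midpoint property enters here.
  obtain ⟨C, hC1, hC⟩ := oscNorm_le_mul_oscNorm hLD hAM hb (b := 2 * b) (by linarith)
  refine ⟨A * C, one_le_mul hA1 hC1, fun f N hf hN hfN k x ρ hρ hρb => ?_⟩
  have h := hA f (C * N) hf (by positivity) (by
    push_cast
    rw [← hfN]
    exact hC 1 f le_rfl hf) k x ρ hρ hρb
  push_cast at h ⊢
  rwa [mul_assoc (A : ℝ≥0∞)]

theorem LocallyDoubling.exists_john_nirenberg (hLD : LocallyDoubling μ)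
    {R₀ β b : ℝ} (hAM : ApproximateMidpoint M R₀ β) (hb : R₀ / (1 - β) < b) :
    ∃ κ C : ℝ, 0 < κ ∧ 0 < C ∧ ∀ (f : M → ℂ) (x : M) (ρ s : ℝ), Integrable f μ →
      oscNorm μ b 1 f < ∞ → 0 < ρ → ρ ≤ b → 0 ≤ s →
      (oscNorm μ b 1 f ≠ 0 →
        μ.real {y ∈ ball x ρ | s < ‖f y - ⨍ z in ball x ρ, f z ∂μ‖} ≤
          C * Real.exp (-(κ * s / (oscNorm μ b 1 f).toReal)) * μ.real (ball x ρ)) ∧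
      (oscNorm μ b 1 f = 0 →
        μ.real {y ∈ ball x ρ | s < ‖f y - ⨍ z in ball x ρ, f z ∂μ‖} = 0) := by
  obtain ⟨A, hA1, hA⟩ := hLD.exists_measure_lt_le_half_pow_oscNorm hAM hb
  have hA0 : (0 : ℝ) < A := by
    have : 0 < A := by positivity
    exact_mod_cast this
  have hlog : 0 < Real.log 2 := Real.log_pos one_lt_two
  -- With `k = ⌊s / (A * N)⌋` one has `2⁻¹ ^ k ≤ 2 * exp (-(log 2 / A) * s / N)`; the factor 2 pays
  -- for the floor.
  refine ⟨Real.log 2 / A, 2, by positivity, two_pos,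
    fun f x ρ s hf hfin hρ hρb hs => ⟨fun hne => ?_, fun h0 => ?_⟩⟩
  · set N : ℝ≥0 := (oscNorm μ b 1 f).toNNReal with hN
    have hNc : oscNorm μ b 1 f = N := (ENNReal.coe_toNNReal hfin.ne).symm
    have hN0 : 0 < N := ENNReal.toNNReal_pos hne hfin.ne
    have hN0' : (0 : ℝ) < N := by exact_mod_cast hN0
    rw [hNc, ENNReal.coe_toReal]
    set k : ℕ := ⌊s / (A * N)⌋₊ with hk
    have hkle : k * (A * N : ℝ) ≤ s := by
      have := Nat.floor_le (a := s / (A * N : ℝ)) (by positivity)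
      rwa [le_div_iff₀ (by positivity)] at this
    have hsub : {y ∈ ball x ρ | s < ‖f y - ⨍ z in ball x ρ, f z ∂μ‖} ⊆
        {y ∈ ball x ρ | (k * (A * N) : ℝ≥0∞) < ‖f y - ⨍ z in ball x ρ, f z ∂μ‖ₑ} := by
      rintro y ⟨hy, hlt⟩
      refine ⟨hy, ?_⟩
      rw [enorm_eq_nnnorm, ← ENNReal.coe_mul, ← ENNReal.coe_natCast, ← ENNReal.coe_mul,
        ENNReal.coe_lt_coe, ← NNReal.coe_lt_coe]
      push_cast
      exact hkle.trans_lt hlt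
    have h1 := (measure_mono hsub).trans (hA f N hf hN0 hNc k x ρ hρ hρb)
    have h2 := ENNReal.toReal_mono (by finiteness) h1
    rw [ENNReal.toReal_mul, ENNReal.toReal_pow, ENNReal.toReal_inv] at h2
    refine h2.trans ?_
    change _ * μ.real _ ≤ _
    gcongr
    have h3 : s / (A * N) < k + 1 := Nat.lt_floor_add_one _
    calc ((2 : ℝ≥0∞).toReal)⁻¹ ^ k = Real.exp (-(Real.log 2 * k)) := by
          rw [← mul_neg, Real.exp_mul, Real.exp_log two_pos, Real.rpow_neg two_pos.le,
            Real.rpow_natCast, inv_pow]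
          simp
      _ ≤ Real.exp (Real.log 2 - Real.log 2 / A * s / N) := by
          refine Real.exp_le_exp.2 ?_
          have : Real.log 2 / A * s / N = Real.log 2 * (s / (A * N)) := by
            field_simp
          rw [this]
          nlinarith
      _ = 2 * Real.exp (-(Real.log 2 / A * s / N)) := by
          rw [sub_eq_add_neg, Real.exp_add, Real.exp_log two_pos]
  · have h := ae_eq_average_of_oscNorm_eq_zero hf h0 (x := x) hρ hρb
    rw [ProbabilityTheory.cond, Filter.EventuallyEq,
      Measure.ae_ennreal_smul_measure_iff (ENNReal.inv_ne_zero.2 (measure_ne_top _ _)),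
      ae_restrict_iff' measurableSet_ball] at h
    rw [Measure.real, ENNReal.toReal_eq_zero_iff]
    left
    refine measure_mono_null ?_ h
    rintro y ⟨hy, hlt⟩ hy0
    have := hy0 hy
    simp only [Pi.zero_apply] at this
    rw [this, norm_zero] at hlt
    exact absurd hlt (not_lt.2 hs)

/-- It suffices to bound the norm with an integer exponent `n + 1 > p`, because the normalised
measure has mass one. There the layer-cake sum meets the geometric decay and leaves the convergent
series `σ`. -/
theorem LocallyDoubling.exists_oscNorm_le_mul (hLD : LocallyDoubling μ)
    {R₀ β b : ℝ} (hAM : ApproximateMidpoint M R₀ β) (hb : R₀ / (1 - β) < b) {p : ℝ≥0∞}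
    (hp : p ≠ ∞) :
    ∃ C : ℝ≥0, ∀ f : M → ℂ, Integrable f μ → oscNorm μ b p f ≤ C * oscNorm μ b 1 f := by
  obtain ⟨A, hA1, hA⟩ := hLD.exists_measure_lt_le_half_pow_oscNorm hAM hb
  obtain ⟨n, hn⟩ := ENNReal.exists_nat_gt hp
  set σ : ℝ≥0∞ := ∑' k : ℕ, ((k + 1 : ℕ) : ℝ≥0∞) ^ (n + 1) * 2⁻¹ ^ k with hσ
  have hσfin : σ ≠ ∞ := by
    have hsum : Summable fun k : ℕ => ((k + 1 : ℕ) : ℝ≥0) ^ (n + 1) * 2⁻¹ ^ k := by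
      rw [← NNReal.summable_coe]
      push_cast
      have := (summable_nat_add_iff 1).2
        (summable_pow_mul_geometric_of_norm_lt_one (n + 1) (r := (2 : ℝ)⁻¹) (by norm_num))
      refine (this.mul_left 2).congr fun k => ?_
      push_cast
      rw [pow_succ (2⁻¹ : ℝ)]
      ring
    have := ENNReal.tsum_coe_ne_top_iff_summable.2 hsum
    convert this using 2
    funext k
    push_cast
    simp
  set e : ℝ := 1 / ((n + 1 : ℕ) : ℝ) with he
  have he0 : 0 ≤ e := by positivity
  -- The summand 1 makes the constant visibly nonzero, so that its product with `∞` is `∞`.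
  refine ⟨A * (σ ^ e).toNNReal + 1, fun f hf => ?_⟩
  have hCne : ((A * (σ ^ e).toNNReal + 1 : ℝ≥0) : ℝ≥0∞) ≠ 0 := by
    rw [ENNReal.coe_ne_zero]
    positivity
  rcases eq_or_ne (oscNorm μ b 1 f) ∞ with htop | hfin
  · rw [htop, ENNReal.mul_top hCne]; exact le_top
  rcases eq_or_ne (oscNorm μ b 1 f) 0 with h0 | hne
  · rw [h0, mul_zero]
    refine iSup_le fun x => iSup₂_le fun ρ hρ => ?_
    rw [eLpNorm_congr_ae (ae_eq_average_of_oscNorm_eq_zero hf h0 (x := x) hρ.1 hρ.2)]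
    simp
  set N : ℝ≥0 := (oscNorm μ b 1 f).toNNReal with hN
  have hNc : oscNorm μ b 1 f = N := (ENNReal.coe_toNNReal hfin).symm
  have hN0 : 0 < N := ENNReal.toNNReal_pos hne hfin
  rw [hNc]
  refine iSup_le fun x => iSup₂_le fun ρ hρ => ?_
  have hB0 := (hLD.measure_ball_pos x hρ.1).ne'
  have := ProbabilityTheory.cond_isProbabilityMeasure hB0
  set ν := ProbabilityTheory.cond μ (ball x ρ) with hν
  set g : M → ℂ := fun y => f y - ⨍ z in ball x ρ, f z ∂μ with hg
  have hgm : AEStronglyMeasurable g ν :=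
    (hf.aestronglyMeasurable.sub aestronglyMeasurable_const).mono_ac
      ProbabilityTheory.cond_absolutelyContinuous
  have hm : ∀ k : ℕ, NullMeasurableSet {y | (k * (A * N : ℝ≥0) : ℝ≥0∞) < ‖g y‖ₑ} ν := fun k =>
    nullMeasurableSet_lt aemeasurable_const hgm.enorm
  have hdist : ∀ k : ℕ, ν {y | (k * (A * N : ℝ≥0) : ℝ≥0∞) < ‖g y‖ₑ} ≤ 2⁻¹ ^ k := by
    intro k
    have h := hA f N hf hN0 hNc k x ρ hρ.1 hρ.2
    rw [hν, ProbabilityTheory.cond_apply measurableSet_ball, mul_comm, ← div_eq_mul_inv,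
      ENNReal.div_le_iff hB0 (measure_ne_top _ _)]
    push_cast
    exact h
  have hlint : ∫⁻ y, ‖g y‖ₑ ^ (n + 1) ∂ν ≤ (A * N : ℝ≥0) ^ (n + 1) * σ := by
    calc ∫⁻ y, ‖g y‖ₑ ^ (n + 1) ∂ν
        ≤ ∫⁻ y, ∑' k : ℕ, {y | (k * (A * N : ℝ≥0) : ℝ≥0∞) < ‖g y‖ₑ}.indicator
            (fun _ => (((k + 1 : ℕ) : ℝ≥0∞) * (A * N : ℝ≥0)) ^ (n + 1)) y ∂ν := by
          refine lintegral_mono fun y => ?_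
          refine (exists_enorm_pow_le_tsum n (a := A * N) (by positivity) ‖g y‖₊).trans ?_
          refine ENNReal.tsum_le_tsum fun k => ?_
          rw [Set.indicator_apply]
          rfl
      _ = ∑' k : ℕ, (((k + 1 : ℕ) : ℝ≥0∞) * (A * N : ℝ≥0)) ^ (n + 1) *
            ν {y | (k * (A * N : ℝ≥0) : ℝ≥0∞) < ‖g y‖ₑ} := by
          rw [lintegral_tsum fun k => aemeasurable_const.indicator₀ (hm k)]
          exact tsum_congr fun k => lintegral_indicator_const₀ (hm k) _
      _ ≤ ∑' k : ℕ, (A * N : ℝ≥0) ^ (n + 1) * (((k + 1 : ℕ) : ℝ≥0∞) ^ (n + 1) * 2⁻¹ ^ k) := by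
          refine ENNReal.tsum_le_tsum fun k => ?_
          rw [mul_pow, mul_comm (_ ^ _) (((A * N : ℝ≥0) : ℝ≥0∞) ^ _), mul_assoc]
          gcongr
          exact hdist k
      _ = _ := ENNReal.tsum_mul_left
  calc eLpNorm g p ν ≤ eLpNorm g ((n + 1 : ℕ) : ℝ≥0∞) ν :=
        eLpNorm_le_eLpNorm_of_exponent_le (hn.le.trans (by gcongr; omega)) hgm
    _ = (∫⁻ y, ‖g y‖ₑ ^ (n + 1) ∂ν) ^ e := by
        rw [eLpNorm_eq_lintegral_rpow_enorm_toReal (by positivity) (ENNReal.natCast_ne_top _)]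
        simp only [ENNReal.toReal_natCast, ENNReal.rpow_natCast, he]
    _ ≤ ((A * N : ℝ≥0) ^ (n + 1) * σ) ^ e := by gcongr
    _ = (A * N : ℝ≥0) * σ ^ e := by
        rw [ENNReal.mul_rpow_of_nonneg _ _ he0, ← ENNReal.rpow_natCast, ← ENNReal.rpow_mul, he,
          mul_one_div_cancel (by positivity), ENNReal.rpow_one]
    _ ≤ _ := by
        rw [← ENNReal.coe_toNNReal (ENNReal.rpow_ne_top_of_nonneg he0 hσfin)]
        norm_cast
        rw [add_mul]
        refine le_add_right (le_of_eq (by ring))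

end JohnNirenbergConsequences

/-! ### Completeness of the Hardy space. -/

section HardyComplete

variable {M : Type*} [MetricSpace M] [MeasurableSpace M] [OpensMeasurableSpace M]
  {μ : Measure M} [IsFiniteMeasure μ] {b : ℝ} {r : ℝ≥0∞}

theorem HardySpace.toL1_injective {M : Type*} [MetricSpace M] [MeasurableSpace M]
    {μ : Measure M} [IsFiniteMeasure μ] {b : ℝ} {r : ℝ≥0∞} :
    Function.Injective (HardySpace.toL1 : HardySpace μ b r → Lp ℂ 1 μ) :=
  Subtype.val_injective

theorem HardySpace.exists_toL1_eq {M : Type*} [MetricSpace M] [MeasurableSpace M]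
    {μ : Measure M} [IsFiniteMeasure μ] {b : ℝ} {r : ℝ≥0∞} {g : Lp ℂ 1 μ} {l : ℕ → ℂ}
    {a : ℕ → Lp ℂ 1 μ} (h : IsAtomicDecomposition μ b r g l a) :
    ∃ G : HardySpace μ b r, G.toL1 = g ∧ ‖G‖ ≤ ∑' k, ‖l k‖ :=
  ⟨⟨g, l, a, h⟩, rfl, HardySpace.norm_le (g := ⟨g, l, a, h⟩) h⟩

theorem HardySpace.exists_decomposition {M : Type*} [MetricSpace M] [MeasurableSpace M]
    {μ : Measure M} [IsFiniteMeasure μ] {b : ℝ} {r : ℝ≥0∞} (g : HardySpace μ b r) :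
    ∃ l a, IsAtomicDecomposition μ b r g.toL1 l a :=
  g.2

theorem IsAtomicDecomposition.norm_atom_le {g : Lp ℂ 1 μ} {l : ℕ → ℂ} {a : ℕ → Lp ℂ 1 μ}
    (hr : 1 ≤ r) (h : IsAtomicDecomposition μ b r g l a) (k : ℕ) : ‖a k‖ ≤ 1 := by
  rcases h.1 k with hk | hk
  · exact hk.norm_le_one hr
  · rw [hk]; exact norm_exceptionalAtom_le μ

/-- A countable family of atomic decompositions can be merged into a single one. -/
theorem IsAtomicDecomposition.exists_tsum (hr : 1 ≤ r) {g : ℕ → Lp ℂ 1 μ} {l : ℕ → ℕ → ℂ}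
    {a : ℕ → ℕ → Lp ℂ 1 μ} (h : ∀ n, IsAtomicDecomposition μ b r (g n) (l n) (a n))
    (hl : Summable fun n => ∑' k, ‖l n k‖) :
    ∃ G : HardySpace μ b r, HasSum g G.toL1 ∧ ‖G‖ ≤ ∑' n, ∑' k, ‖l n k‖ := by
  have e : ℕ × ℕ ≃ ℕ := Nat.pairEquiv
  have hs : Summable fun i : ℕ × ℕ => ‖l i.1 i.2‖ :=
    (summable_prod_of_nonneg fun _ => norm_nonneg _).2 ⟨fun n => (h n).2.1, hl⟩
  have hsa : Summable fun i : ℕ × ℕ => l i.1 i.2 • a i.1 i.2 := by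
    refine Summable.of_norm_bounded hs fun i => ?_
    rw [norm_smul]
    exact mul_le_of_le_one_right (norm_nonneg _) ((h i.1).norm_atom_le hr i.2)
  have hdec : IsAtomicDecomposition μ b r (∑' i : ℕ × ℕ, l i.1 i.2 • a i.1 i.2)
      (fun k => l (e.symm k).1 (e.symm k).2) (fun k => a (e.symm k).1 (e.symm k).2) := by
    refine ⟨fun k => (h _).1 _, ?_, ?_⟩
    · exact (Equiv.summable_iff e.symm (f := fun i : ℕ × ℕ => ‖l i.1 i.2‖)).2 hs
    · exact (Equiv.hasSum_iff e.symm (f := fun i : ℕ × ℕ => l i.1 i.2 • a i.1 i.2)).2 hsa.hasSum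
  obtain ⟨G, hG, hGn⟩ := HardySpace.exists_toL1_eq hdec
  refine ⟨G, ?_, hGn.trans (le_of_eq ?_)⟩
  · rw [hG]
    exact hsa.hasSum.prod_fiberwise fun n => (h n).2.2
  · rw [Equiv.tsum_eq e.symm (fun i : ℕ × ℕ => ‖l i.1 i.2‖)]
    exact hs.tsum_prod' fun n => (h n).2.1

/-- Decompositions of `u n` that are optimal up to `ε / 2 ^ (n + 1)` are merged into one
decomposition of the sum. -/
theorem HardySpace.exists_hasSum [hr : Fact (1 < r)] {u : ℕ → HardySpace μ b r}
    (hu : Summable fun n => ‖u n‖) :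
    ∃ G : HardySpace μ b r, HasSum (fun n => (u n).toL1) G.toL1 ∧ ‖G‖ ≤ ∑' n, ‖u n‖ := by
  have key : ∀ ε : ℝ, 0 < ε → ∃ G : HardySpace μ b r, HasSum (fun n => (u n).toL1) G.toL1 ∧
      ‖G‖ ≤ ∑' n, ‖u n‖ + ε := by
    intro ε hε
    have hdec : ∀ n, ∃ l a, IsAtomicDecomposition μ b r (u n).toL1 l a ∧
        ∑' k, ‖l k‖ ≤ ‖u n‖ + ε / 2 / 2 ^ n := by
      intro n
      by_contra! hcon
      have h1 : ‖u n‖ + ε / 2 / 2 ^ n ≤ ‖u n‖ :=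
        HardySpace.le_norm fun l a h => (hcon l a h).le
      have : 0 < ε / 2 / 2 ^ n := by positivity
      linarith
    choose l a hd hla using hdec
    have hgeo := hasSum_geometric_two' ε
    have hs := hu.add hgeo.summable
    have hl : Summable fun n => ∑' k, ‖l n k‖ :=
      Summable.of_nonneg_of_le (fun n => tsum_nonneg fun _ => norm_nonneg _) hla hs
    obtain ⟨G, hG, hGn⟩ := IsAtomicDecomposition.exists_tsum hr.out.le hd hl
    refine ⟨G, hG, hGn.trans ?_⟩
    rw [← hgeo.tsum_eq, ← hu.tsum_add hgeo.summable]
    exact hl.tsum_le_tsum hla hs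
  -- The sum in `L¹` is unique, so the same element satisfies the bound for every `ε`.
  obtain ⟨G, hG, -⟩ := key 1 one_pos
  refine ⟨G, hG, le_of_forall_pos_le_add fun ε hε => ?_⟩
  obtain ⟨G', hG', hn⟩ := key ε hε
  rwa [HardySpace.toL1_injective (hG.unique hG')]

/-- Absolutely convergent series suffice. The remainder after `m` terms is the sum of the shifted
series, so its norm is at most a tail of `∑ ‖u n‖`. -/
theorem completeSpace_HardySpace [hr : Fact (1 < r)] :
    CompleteSpace (HardySpace μ b r) := by
  refine NormedAddCommGroup.completeSpace_of_summable_imp_tendsto fun u hu => ?_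
  obtain ⟨G, hG, -⟩ := HardySpace.exists_hasSum hu
  refine ⟨G, tendsto_iff_norm_sub_tendsto_zero.2 ?_⟩
  refine squeeze_zero (fun _ => norm_nonneg _) (fun m => ?_)
    (tendsto_sum_nat_add fun n => ‖u n‖)
  obtain ⟨G', hG', hn⟩ := HardySpace.exists_hasSum (u := fun n => u (n + m))
    ((summable_nat_add_iff (f := fun n => ‖u n‖) m).2 hu)
  have hGG' : G - ∑ i ∈ Finset.range m, u i = G' := by
    refine HardySpace.toL1_injective ?_
    rw [map_sub, map_sum]
    exact (hasSum_nat_add_iff' m).2 hG |>.unique hG'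
  rwa [norm_sub_rev, hGG']

end HardyComplete

/-! ### The Hardy norm as an extended norm on `L¹`. -/

section HardyEnorm

variable {M : Type*} [MetricSpace M] [MeasurableSpace M] [OpensMeasurableSpace M]
  {μ : Measure M} [IsFiniteMeasure μ] {b : ℝ} {r : ℝ≥0∞} [hr : Fact (1 < r)]

/-- The norm of `H_b^{1,r}(μ)` as an extended norm on `L¹(μ)`. -/
noncomputable def hardyENorm (μ : Measure M) [IsFiniteMeasure μ] (b : ℝ) (r : ℝ≥0∞)
    [Fact (1 < r)] (g : Lp ℂ 1 μ) : ℝ≥0∞ :=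
  ⨅ (G : HardySpace μ b r) (_ : G.toL1 = g), ‖G‖ₑ

theorem hardyENorm_toL1 (G : HardySpace μ b r) : hardyENorm μ b r G.toL1 = ‖G‖ₑ := by
  refine le_antisymm (iInf₂_le (f := fun (G' : HardySpace μ b r) (_ : G'.toL1 = G.toL1) => ‖G'‖ₑ)
    G rfl) (le_iInf₂ fun G' h => ?_)
  rw [HardySpace.toL1_injective h]

theorem exists_toL1_eq_of_hardyENorm_lt {g : Lp ℂ 1 μ} (h : hardyENorm μ b r g < ∞) :
    ∃ G : HardySpace μ b r, G.toL1 = g := by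
  by_contra! hcon
  refine absurd h (not_lt.2 (le_iInf₂ fun G hG => absurd hG (hcon G)))

/-- No membership is assumed, so this provides the triangle inequality that the chain bound asks
for. -/
theorem hardyENorm_add_le (g g' : Lp ℂ 1 μ) :
    hardyENorm μ b r (g + g') ≤ hardyENorm μ b r g + hardyENorm μ b r g' := by
  rcases eq_or_ne (hardyENorm μ b r g) ∞ with h | h
  · simp [h]
  rcases eq_or_ne (hardyENorm μ b r g') ∞ with h' | h'
  · simp [h']
  obtain ⟨G, rfl⟩ := exists_toL1_eq_of_hardyENorm_lt h.lt_top
  obtain ⟨G', rfl⟩ := exists_toL1_eq_of_hardyENorm_lt h'.lt_top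
  rw [← map_add, hardyENorm_toL1, hardyENorm_toL1, hardyENorm_toL1]
  exact enorm_add_le _ _

theorem hardyENorm_smul_le (z : ℂ) (g : Lp ℂ 1 μ) (hg : hardyENorm μ b r g ≠ ∞) :
    hardyENorm μ b r (z • g) ≤ ‖z‖ₑ * hardyENorm μ b r g := by
  obtain ⟨G, rfl⟩ := exists_toL1_eq_of_hardyENorm_lt hg.lt_top
  rw [← map_smul, hardyENorm_toL1, hardyENorm_toL1, enorm_smul]

theorem hardyENorm_neg (g : Lp ℂ 1 μ) : hardyENorm μ b r (-g) = hardyENorm μ b r g := by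
  have h : ∀ g : Lp ℂ 1 μ, hardyENorm μ b r (-g) ≤ hardyENorm μ b r g := by
    intro g
    refine le_iInf₂ fun G hG => ?_
    subst hG
    rw [← map_neg, hardyENorm_toL1, enorm_neg]
  refine le_antisymm (h g) ?_
  simpa using h (-g)

theorem hardyENorm_sum_le {ι : Type*} (F : Finset ι) (g : ι → Lp ℂ 1 μ) :
    hardyENorm μ b r (∑ i ∈ F, g i) ≤ ∑ i ∈ F, hardyENorm μ b r (g i) := by
  classical
  induction F using Finset.induction_on with
  | empty =>
    have := hardyENorm_toL1 (0 : HardySpace μ b r)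
    rw [map_zero, enorm_zero] at this
    simp [this]
  | insert i F hi ih =>
    rw [Finset.sum_insert hi, Finset.sum_insert hi]
    exact (hardyENorm_add_le _ _).trans (by gcongr)

/-- A function with the support and cancellation properties of an atom and `A` times its size. -/
theorem hardyENorm_le_of_support {x : M} {ρ : ℝ} (hρ : 0 < ρ) (hρb : ρ ≤ b) {g : Lp ℂ 1 μ}
    (hsupp : ∀ᵐ y ∂μ, y ∉ ball x ρ → g y = 0) {A : ℝ≥0} (hA : 0 < A)
    (hnorm : eLpNorm g r (ProbabilityTheory.cond μ (ball x ρ)) ≤ A * (μ (ball x ρ))⁻¹)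
    (hint : ∫ y, g y ∂μ = 0) : hardyENorm μ b r g ≤ A := by
  have hA0 : ((A : ℝ) : ℂ) ≠ 0 := by
    have : (A : ℝ) ≠ 0 := by exact_mod_cast hA.ne'
    exact_mod_cast this
  have hsm := Lp.coeFn_smul (((A : ℝ) : ℂ)⁻¹) g
  have hatom : IsStandardAtom μ b r (((A : ℝ) : ℂ)⁻¹ • g) := by
    refine ⟨x, ρ, hρ, hρb, ?_, ?_, ?_⟩
    · filter_upwards [hsupp, hsm] with y hy hy' hyB
      rw [hy', Pi.smul_apply, hy hyB, smul_zero]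
    · rw [eLpNorm_congr_ae (ProbabilityTheory.cond_absolutelyContinuous.ae_le hsm),
        eLpNorm_const_smul]
      have hne : (A : ℝ≥0∞) ≠ 0 := by exact_mod_cast hA.ne'
      have henorm : ‖((A : ℝ) : ℂ)⁻¹‖ₑ = (A : ℝ≥0∞)⁻¹ := by
        rw [enorm_inv hA0, enorm_eq_nnnorm, Complex.nnnorm_real]
        simp
      rw [henorm]
      calc (A : ℝ≥0∞)⁻¹ * eLpNorm g r (ProbabilityTheory.cond μ (ball x ρ))
          ≤ (A : ℝ≥0∞)⁻¹ * (A * (μ (ball x ρ))⁻¹) := by gcongr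
        _ = _ := by rw [← mul_assoc, ENNReal.inv_mul_cancel hne ENNReal.coe_ne_top, one_mul]
    · rw [integral_congr_ae (ae_restrict_of_ae hsm)]
      simp only [Pi.smul_apply]
      rw [integral_smul, setIntegral_eq_integral_of_ae_compl_eq_zero hsupp, hint, smul_zero]
  have hdec : IsAtomicDecomposition μ b r g (fun k => if k = 0 then ((A : ℝ) : ℂ) else 0)
      (fun _ => ((A : ℝ) : ℂ)⁻¹ • g) := by
    refine ⟨fun _ => Or.inl hatom, ?_, ?_⟩
    · refine summable_of_ne_finset_zero (s := {0}) fun k hk => ?_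
      simp only [Finset.mem_singleton] at hk
      simp [hk]
    · convert hasSum_ite_eq (0 : ℕ) g using 2 with k
      beta_reduce
      split_ifs
      · rw [smul_smul, mul_inv_cancel₀ hA0, one_smul]
      · rw [zero_smul]
  obtain ⟨G, rfl, hG⟩ := HardySpace.exists_toL1_eq hdec
  rw [hardyENorm_toL1]
  rw [tsum_eq_single 0 (fun k hk => by simp [hk])] at hG
  rw [← ofReal_norm]
  refine ENNReal.ofReal_le_of_le_toReal (hG.trans ?_)
  simp

end HardyEnorm

/-! ### Cutting functions along finite covers. -/

/-- Disjointification of a finite cover, in the form of a partition of functions. -/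
theorem exists_measurable_partition {M ι : Type*} [MeasurableSpace M] (F : Finset ι)
    {B : ι → Set M} (hB : ∀ i, MeasurableSet (B i)) :
    ∃ E : ι → Set M, (∀ i, MeasurableSet (E i)) ∧ (∀ i, E i ⊆ B i) ∧
      ∀ g : M → ℂ, ∀ z ∈ ⋃ i ∈ F, B i, ∑ i ∈ F, (E i).indicator g z = g z := by
  classical
  induction F using Finset.induction_on with
  | empty => exact ⟨B, hB, fun _ => subset_rfl, by simp⟩
  | insert i F hi ih =>
    obtain ⟨E, hE, hEB, hsum⟩ := ih
    have hU : MeasurableSet (⋃ j ∈ F, B j) := F.measurableSet_biUnion fun j _ => hB j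
    refine ⟨Function.update E i (B i \ ⋃ j ∈ F, B j), fun j => ?_, fun j => ?_, fun g z hz => ?_⟩
    · rcases eq_or_ne j i with rfl | hj
      · rw [Function.update_self]; exact (hB _).diff hU
      · rw [Function.update_of_ne hj]; exact hE j
    · rcases eq_or_ne j i with rfl | hj
      · rw [Function.update_self]; exact Set.sdiff_subset
      · rw [Function.update_of_ne hj]; exact hEB j
    · have hrest : ∑ j ∈ F, (Function.update E i (B i \ ⋃ j ∈ F, B j) j).indicator g z =
          ∑ j ∈ F, (E j).indicator g z :=
        Finset.sum_congr rfl fun j hj => by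
          rw [Function.update_of_ne (ne_of_mem_of_not_mem hj hi)]
      rw [Finset.sum_insert hi, Function.update_self, hrest]
      by_cases hzF : z ∈ ⋃ j ∈ F, B j
      · rw [hsum g z hzF, Set.indicator_of_notMem (fun h => h.2 hzF), zero_add]
      · have hzi : z ∈ B i := by
          rw [Finset.set_biUnion_insert] at hz
          exact hz.resolve_right hzF
        rw [Set.indicator_of_mem (show z ∈ B i \ ⋃ j ∈ F, B j from ⟨hzi, hzF⟩),
          Finset.sum_eq_zero, add_zero]
        intro j hj
        exact Set.indicator_of_notMem
          (fun h => hzF (Set.mem_iUnion₂.2 ⟨j, hj, hEB j h⟩)) _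

theorem Lp_coeFn_finset_sum {M ι : Type*} [MeasurableSpace M] {μ : Measure M} (F : Finset ι)
    (u : ι → Lp ℂ 1 μ) : ⇑(∑ i ∈ F, u i) =ᵐ[μ] fun z => ∑ i ∈ F, u i z := by
  classical
  induction F using Finset.induction_on with
  | empty =>
    simp only [Finset.sum_empty]
    exact Lp.coeFn_zero ℂ 1 μ
  | insert i F hi ih =>
    simp only [Finset.sum_insert hi]
    filter_upwards [Lp.coeFn_add (u i) (∑ j ∈ F, u j), ih] with z h1 h2
    rw [h1, Pi.add_apply, h2]

/-! ### Normalised indicators of balls. -/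

section BallIndicator

variable {M : Type*} [MetricSpace M] [MeasurableSpace M] [OpensMeasurableSpace M]

/-- The normalised indicator function of a ball. -/
noncomputable def ballBump (μ : Measure M) [IsFiniteMeasure μ] (η : ℝ) (x : M) : Lp ℂ 1 μ :=
  indicatorConstLp 1 (measurableSet_ball (x := x) (ε := η)) (measure_ne_top μ _)
    (((μ.real (ball x η))⁻¹ : ℝ) : ℂ)

variable {μ : Measure M} [IsFiniteMeasure μ]

theorem ballBump_eq_zero (η : ℝ) (x : M) : ∀ᵐ y ∂μ, y ∉ ball x η → ballBump μ η x y = 0 := by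
  filter_upwards [indicatorConstLp_coeFn (p := 1) (hs := measurableSet_ball (x := x) (ε := η))
    (hμs := measure_ne_top μ _) (c := (((μ.real (ball x η))⁻¹ : ℝ) : ℂ))] with y hy hyB
  rw [ballBump, hy, Set.indicator_of_notMem hyB]

theorem integral_ballBump {η : ℝ} {x : M} (h0 : μ (ball x η) ≠ 0) :
    ∫ y, ballBump μ η x y ∂μ = 1 := by
  rw [ballBump, integral_indicatorConstLp]
  have : μ.real (ball x η) ≠ 0 := by
    rw [Measure.real, ENNReal.toReal_ne_zero]
    exact ⟨h0, measure_ne_top _ _⟩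
  rw [Complex.real_smul, ← Complex.ofReal_mul, mul_inv_cancel₀ this, Complex.ofReal_one]

/-- A pointwise bound passes to the norm of any exponent over a probability measure, so one estimate
serves every `r`. -/
theorem eLpNorm_ballBump_le {η : ℝ} {x : M} (h0 : μ (ball x η) ≠ 0) (r : ℝ≥0∞) {S : Set M}
    (hS : μ S ≠ 0) :
    eLpNorm (ballBump μ η x) r (ProbabilityTheory.cond μ S) ≤ (μ (ball x η))⁻¹ := by
  have := ProbabilityTheory.cond_isProbabilityMeasure hS
  have h : ∀ᵐ y ∂(ProbabilityTheory.cond μ S), ‖ballBump μ η x y‖ₑ ≤ (μ (ball x η))⁻¹ := by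
    refine ProbabilityTheory.cond_absolutelyContinuous.ae_le ?_
    filter_upwards [indicatorConstLp_coeFn (p := 1) (hs := measurableSet_ball (x := x) (ε := η))
      (hμs := measure_ne_top μ _) (c := (((μ.real (ball x η))⁻¹ : ℝ) : ℂ))] with y hy
    rw [ballBump, hy]
    refine (enorm_indicator_le_enorm_self _ _).trans (le_of_eq ?_)
    rw [← ofReal_norm, Complex.norm_real, Real.norm_of_nonneg (by positivity),
      Measure.real, ENNReal.ofReal_inv_of_pos (ENNReal.toReal_pos h0 (measure_ne_top _ _)),
      ENNReal.ofReal_toReal (measure_ne_top _ _)]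
  refine (eLpNorm_le_of_ae_enorm_bound h).trans (le_of_eq ?_)
  simp

end BallIndicator

theorem ENNReal.inv_le_mul_inv {s t K : ℝ≥0∞} (h : t ≤ K * s) (ht : t ≠ 0)
    (ht' : t ≠ ∞) : s⁻¹ ≤ K * t⁻¹ := by
  rw [← div_eq_mul_inv, ENNReal.le_div_iff_mul_le (Or.inl ht) (Or.inl ht'), mul_comm,
    ← div_eq_mul_inv]
  exact ENNReal.div_le_of_le_mul h

/-! ### Change of scale for the Hardy space. -/

section HardyScale

variable {M : Type*} [MetricSpace M] [MeasurableSpace M] [OpensMeasurableSpace M]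
  {μ : Measure M} [IsFiniteMeasure μ] [NeZero μ]

/-- Let `w y` be the integral of `a` over the piece `E y` of a partition of its ball. Each piece
minus `w y` times a bump at `y` is a bounded multiple of an atom at scale `c`. The remaining bumps
satisfy `∑ w y = 0`, so each may be compared with the bump at `x`, which a chain does at bounded
cost. -/
theorem exists_hardyENorm_standardAtom_le (hLD : LocallyDoubling μ) {R₀ β b c : ℝ}
    (hAM : ApproximateMidpoint M R₀ β) (hc : R₀ / (1 - β) < c) (r : ℝ≥0∞)
    [hr : Fact (1 < r)] :
    ∃ C : ℝ≥0, ∀ a : Lp ℂ 1 μ, IsStandardAtom μ b r a → hardyENorm μ c r a ≤ C := by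
  obtain ⟨hR0, hRc⟩ := hAM.lt_of_div_lt hc
  have hr1 : 1 ≤ r := hr.out.le
  obtain ⟨δ, hδ⟩ : ∃ δ, δ = (R₀ + c) / 2 := ⟨_, rfl⟩
  obtain ⟨η, hη⟩ : ∃ η, η = (c - R₀) / 2 := ⟨_, rfl⟩
  have hη0 : 0 < η := by linarith
  have hc0 : 0 < c := by linarith
  obtain ⟨K, hK1, hK⟩ := hLD.exists_measure_ball_le hη0 (2 * |b| + c + δ + η)
  obtain ⟨m, hm⟩ := hAM.exists_chain_bound (δ := δ) (by linarith) (by linarith) b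
  obtain ⟨n, hn⟩ := hLD.exists_finset_cover hη0 b
  have hb0 := abs_nonneg b
  have hbb := le_abs_self b
  have hK0 : 0 < K := by positivity
  have hpos : ∀ (x : M) {ρ : ℝ}, 0 < ρ → μ (ball x ρ) ≠ 0 := fun x ρ hρ =>
    (hLD.measure_ball_pos x hρ).ne'
  have hinv : ∀ (x y : M) (s t : ℝ), 0 < s → η ≤ t → dist x y + s ≤ 2 * |b| + c + δ + η →
      (μ (ball y t))⁻¹ ≤ K * (μ (ball x s))⁻¹ := by
    intro x y s t hs ht hst
    refine ENNReal.inv_le_mul_inv ?_ (hpos x hs)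
      (measure_ne_top _ _)
    calc μ (ball x s) ≤ μ (ball y (2 * |b| + c + δ + η)) :=
          measure_mono (ball_subset_ball' (by linarith))
      _ ≤ K * μ (ball y η) := hK y
      _ ≤ _ := by gcongr
  -- For centres within `δ`, both bumps live in `ball x c` because `δ + η = c`, and their difference
  -- has mean zero: it is `K + K` times an atom.
  have hchain := hm (fun x y => hardyENorm μ c r (ballBump μ η x - ballBump μ η y)) (K + K : ℝ≥0)
    (fun x y => by rw [← hardyENorm_neg, neg_sub])
    (fun x y z => by
      refine le_trans (le_of_eq ?_) (hardyENorm_add_le _ _)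
      rw [sub_add_sub_cancel])
    (fun x y hxy => by
      have hsub := Lp.coeFn_sub (ballBump μ η x) (ballBump μ η y)
      refine hardyENorm_le_of_support (x := x) hc0 le_rfl ?_ (by positivity) ?_ ?_
      · filter_upwards [hsub, ballBump_eq_zero (μ := μ) η x, ballBump_eq_zero (μ := μ) η y]
          with z h1 h2 h3 hz
        rw [h1, Pi.sub_apply, h2, h3, sub_zero]
        · exact fun h => hz (ball_subset_ball' (by rw [dist_comm]; linarith) h)
        · exact fun h => hz (ball_subset_ball (by linarith) h)
      · rw [eLpNorm_congr_ae (ProbabilityTheory.cond_absolutelyContinuous.ae_le hsub)]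
        refine (eLpNorm_sub_le ((Lp.aestronglyMeasurable _).mono_ac
          ProbabilityTheory.cond_absolutelyContinuous) ((Lp.aestronglyMeasurable _).mono_ac
          ProbabilityTheory.cond_absolutelyContinuous) hr1).trans ?_
        rw [ENNReal.coe_add, add_mul]
        refine add_le_add ((eLpNorm_ballBump_le (hpos x hη0) r (hpos x hc0)).trans ?_)
          ((eLpNorm_ballBump_le (hpos y hη0) r (hpos x hc0)).trans ?_)
        · exact hinv x x c η hc0 le_rfl (by rw [dist_self]; linarith)
        · exact hinv x y c η hc0 le_rfl (by linarith)
      · rw [integral_congr_ae hsub]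
        simp only [Pi.sub_apply]
        rw [integral_sub (L1.integrable_coeFn _) (L1.integrable_coeFn _),
          integral_ballBump (hpos x hη0), integral_ballBump (hpos y hη0), sub_self])
  -- The summand 1 serves atoms with `ρ ≤ c`. Otherwise each of the at most `n` pieces costs `K * K`
  -- for the restricted atom, `K` for its bump, and `m * (K + K)` for the transport of the bump.
  refine ⟨1 + (n * (K * K + K) + n * (m * (K + K))), fun a ha => ?_⟩
  obtain ⟨x, ρ, hρ, hρb, hsupp, hnorm, hint⟩ := id ha
  have hint' : ∫ y, a y ∂μ = 0 := by
    rwa [setIntegral_eq_integral_of_ae_compl_eq_zero hsupp] at hint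
  push_cast
  rcases le_total ρ c with hρc | hcρ
  · refine le_add_right ?_
    have := hardyENorm_le_of_support (b := c) (r := r) hρ hρc hsupp one_pos
      (by simpa using hnorm) hint'
    simpa using this
  refine le_trans ?_ le_add_self
  obtain ⟨F, hFn, hFx, hFcov⟩ := hn x ρ hρb
  -- Intersecting with `ball x ρ` keeps the pieces inside the ball on which the size of `a` is
  -- known.
  obtain ⟨E, hE, hEB, hsum⟩ := exists_measurable_partition F (B := fun y => ball y η ∩ ball x ρ)
    (fun y => measurableSet_ball.inter measurableSet_ball)
  have hmem : ∀ y, MemLp ((E y).indicator a) 1 μ := fun y => (Lp.memLp a).indicator (hE y)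
  set w : M → ℂ := fun y => ∫ z in E y, a z ∂μ with hw
  have hw1 : ∀ y, ‖w y‖ₑ ≤ 1 := by
    intro y
    calc ‖w y‖ₑ ≤ ∫⁻ z in E y, ‖a z‖ₑ ∂μ := enorm_integral_le_lintegral_enorm _
      _ ≤ ∫⁻ z, ‖a z‖ₑ ∂μ := setLIntegral_le_lintegral _ _
      _ = ENNReal.ofReal ‖a‖ := by
          rw [← eLpNorm_one_eq_lintegral_enorm, Lp.norm_def,
            ENNReal.ofReal_toReal (Lp.eLpNorm_ne_top a)]
      _ ≤ 1 := by
          rw [ENNReal.ofReal_le_one]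
          exact ha.norm_le_one hr1
  have hae : ∀ᵐ z ∂μ, ∑ y ∈ F, (E y).indicator a z = a z := by
    filter_upwards [hsupp] with z hz
    by_cases hzB : z ∈ ball x ρ
    · refine hsum a z ?_
      obtain ⟨y, hy, hzy⟩ := Set.mem_iUnion₂.1 (hFcov hzB)
      exact Set.mem_iUnion₂.2 ⟨y, hy, hzy, hzB⟩
    · rw [hz hzB]
      refine Finset.sum_eq_zero fun y _ => ?_
      exact Set.indicator_of_notMem (fun h => hzB (hEB y h).2) _
  have hsumL : ∑ y ∈ F, (hmem y).toLp = a := by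
    refine Lp.ext ?_
    have h1 : ∀ᵐ z ∂μ, ∀ y ∈ F, (hmem y).toLp _ z = (E y).indicator a z :=
      (Filter.eventually_all_finset F).2 fun y _ => (hmem y).coeFn_toLp
    filter_upwards [Lp_coeFn_finset_sum F fun y => (hmem y).toLp, h1, hae] with z h2 h3 h4
    rw [h2, ← h4]
    exact Finset.sum_congr rfl h3
  have hsumw : ∑ y ∈ F, w y = 0 := by
    rw [← hint', ← integral_congr_ae hae, integral_finsetSum F fun y _ =>
      memLp_one_iff_integrable.1 (hmem y)]
    exact Finset.sum_congr rfl fun y _ => (integral_indicator (hE y)).symm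
  -- The bump at `x` may be inserted freely since its total coefficient `∑ w y` vanishes.
  have hdecomp : a = ∑ y ∈ F, ((hmem y).toLp - w y • ballBump μ η y) +
      ∑ y ∈ F, w y • (ballBump μ η y - ballBump μ η x) := by
    simp only [smul_sub, Finset.sum_sub_distrib, ← Finset.sum_smul]
    rw [hsumL, hsumw, zero_smul]
    abel
  rw [hdecomp]
  refine (hardyENorm_add_le _ _).trans (add_le_add ?_ ?_)
  · refine (hardyENorm_sum_le _ _).trans
      ((Finset.sum_le_card_nsmul _ _ ((K * K + K : ℝ≥0) : ℝ≥0∞) fun y hy => ?_).trans ?_)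
    · have hyx : dist y x < ρ := hFx hy
      have hcoe : ⇑((hmem y).toLp - w y • ballBump μ η y) =ᵐ[μ]
          (E y).indicator a - w y • ⇑(ballBump μ η y) := by
        filter_upwards [Lp.coeFn_sub (hmem y).toLp (w y • ballBump μ η y), (hmem y).coeFn_toLp,
          Lp.coeFn_smul (w y) (ballBump μ η y)] with z h1 h2 h3
        rw [h1, Pi.sub_apply, h2, h3, Pi.sub_apply]
      refine hardyENorm_le_of_support (x := y) hc0 le_rfl ?_ (by positivity) ?_ ?_
      · filter_upwards [hcoe, ballBump_eq_zero (μ := μ) η y] with z h1 h2 hz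
        have hzη : z ∉ ball y η := fun h => hz (ball_subset_ball (by linarith) h)
        rw [h1, Pi.sub_apply, Pi.smul_apply, h2 hzη,
          Set.indicator_of_notMem (fun h => hzη (hEB y h).1), smul_zero, sub_zero]
      · rw [eLpNorm_congr_ae (ProbabilityTheory.cond_absolutelyContinuous.ae_le hcoe)]
        refine (eLpNorm_sub_le ((hmem y).aestronglyMeasurable.mono_ac
          ProbabilityTheory.cond_absolutelyContinuous) (((Lp.aestronglyMeasurable _).mono_ac
          ProbabilityTheory.cond_absolutelyContinuous).const_smul _) hr1).trans ?_
        rw [ENNReal.coe_add, add_mul, ENNReal.coe_mul, mul_assoc]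
        refine add_le_add ?_ ?_
        · refine (eLpNorm_indicator_cond_le (hE y) (fun z hz => (hEB y hz).2) hK1 (hpos x hρ)
            ?_ hr1 a).trans ?_
          · calc μ (ball x ρ) ≤ μ (ball y (2 * |b| + c + δ + η)) :=
                  measure_mono (ball_subset_ball' (by rw [dist_comm]; linarith))
              _ ≤ K * μ (ball y η) := hK y
              _ ≤ _ := by gcongr; linarith
          · gcongr
            exact hnorm.trans (hinv y x c ρ hc0 (by linarith) (by linarith))
        · rw [eLpNorm_const_smul]
          refine (mul_le_of_le_one_left zero_le (hw1 y)).trans ?_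
          refine (eLpNorm_ballBump_le (hpos y hη0) r (hpos y hc0)).trans ?_
          exact hinv y y c η hc0 le_rfl (by rw [dist_self]; linarith)
      · rw [integral_congr_ae hcoe]
        rw [integral_sub' (memLp_one_iff_integrable.1 (hmem y))
          ((L1.integrable_coeFn (ballBump μ η y)).smul (w y)), Pi.smul_def, integral_smul,
          integral_ballBump (hpos y hη0), integral_indicator (hE y), smul_eq_mul, mul_one, sub_self]
    · rw [nsmul_eq_mul]
      push_cast
      gcongr
  · refine (hardyENorm_sum_le _ _).trans
      ((Finset.sum_le_card_nsmul _ _ (m * ((K + K : ℝ≥0) : ℝ≥0∞)) fun y hy => ?_).trans ?_)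
    · have hyx : dist y x < ρ := hFx hy
      have h := hchain y x (by linarith)
      refine (hardyENorm_smul_le _ _ (ne_top_of_le_ne_top (by finiteness) h)).trans ?_
      exact (mul_le_of_le_one_left zero_le (hw1 y)).trans h
    · rw [nsmul_eq_mul]
      push_cast
      gcongr

/-- A uniform bound on atoms extends to all elements: the series of images converges absolutely in
the Hardy norm at scale `c`, and its sum is identified in `L¹`. -/
theorem exists_hardySpace_norm_le (hLD : LocallyDoubling μ) {R₀ β b c : ℝ}
    (hAM : ApproximateMidpoint M R₀ β) (hc : R₀ / (1 - β) < c) (r : ℝ≥0∞)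
    [hr : Fact (1 < r)] :
    ∃ C : ℝ, ∀ g : HardySpace μ b r, ∃ G : HardySpace μ c r, G.toL1 = g.toL1 ∧
      ‖G‖ ≤ C * ‖g‖ := by
  obtain ⟨C, hC⟩ := exists_hardyENorm_standardAtom_le hLD hAM hc r (b := b)
  -- `C` covers the standard atoms and 1 the exceptional atom, which is admissible at every scale;
  -- the sum is also positive, as the later division requires.
  refine ⟨C + 1, fun g => ?_⟩
  have hatom : ∀ a : Lp ℂ 1 μ, IsStandardAtom μ b r a ∨ a = exceptionalAtom μ →
      ∃ G : HardySpace μ c r, G.toL1 = a ∧ ‖G‖ ≤ C + 1 := by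
    rintro a (ha | rfl)
    · have h := hC a ha
      obtain ⟨G, rfl⟩ := exists_toL1_eq_of_hardyENorm_lt (h.trans_lt ENNReal.coe_lt_top)
      refine ⟨G, rfl, ?_⟩
      rw [hardyENorm_toL1, enorm_eq_nnnorm, ENNReal.coe_le_coe, ← NNReal.coe_le_coe,
        coe_nnnorm] at h
      linarith
    · have hdec : IsAtomicDecomposition μ c r (exceptionalAtom μ)
          (fun k => if k = 0 then 1 else 0) (fun _ => exceptionalAtom μ) := by
        refine ⟨fun _ => Or.inr rfl, ?_, ?_⟩
        · refine summable_of_ne_finset_zero (s := {0}) fun k hk => ?_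
          simp only [Finset.mem_singleton] at hk
          simp [hk]
        · convert hasSum_ite_eq (0 : ℕ) (exceptionalAtom μ) using 2 with k
          beta_reduce
          split_ifs <;> simp
      obtain ⟨G, hG, hGn⟩ := HardySpace.exists_toL1_eq hdec
      refine ⟨G, hG, hGn.trans ?_⟩
      rw [tsum_eq_single 0 (fun k hk => by simp [hk])]
      simp
  have key : ∀ l a, IsAtomicDecomposition μ b r g.toL1 l a →
      ∃ G : HardySpace μ c r, G.toL1 = g.toL1 ∧ ‖G‖ ≤ (C + 1) * ∑' k, ‖l k‖ := by
    intro l a h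
    choose G hG hGn using fun k => hatom (a k) (h.1 k)
    have hle : ∀ k, ‖l k • G k‖ ≤ (C + 1) * ‖l k‖ := fun k => by
      rw [norm_smul, mul_comm]
      gcongr
      exact hGn k
    have hs : Summable fun k => ‖l k • G k‖ :=
      Summable.of_nonneg_of_le (fun _ => norm_nonneg _) hle (h.2.1.mul_left _)
    obtain ⟨H, hH, hHn⟩ := HardySpace.exists_hasSum hs
    refine ⟨H, hH.unique ?_, hHn.trans ?_⟩
    · convert h.2.2 using 2 with k
      rw [map_smul, hG]
    · rw [← tsum_mul_left]
      exact hs.tsum_le_tsum hle (h.2.1.mul_left _)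
  obtain ⟨l, a, h⟩ := g.exists_decomposition
  obtain ⟨G, hG, -⟩ := key l a h
  refine ⟨G, hG, ?_⟩
  have hC0 : (0 : ℝ) < C + 1 := by positivity
  rw [← div_le_iff₀' hC0]
  refine HardySpace.le_norm fun l a h => ?_
  obtain ⟨G', hG', hn⟩ := key l a h
  rwa [div_le_iff₀' hC0, HardySpace.toL1_injective (hG.trans hG'.symm)]

end HardyScale

/-! ### Isomorphisms over `L¹` and conclusion. -/

/-- Maps that commute with the inclusions into `L¹` are automatically linear and mutually inverse
because these inclusions are injective. -/
theorem exists_hardySpace_equiv {M : Type*} [MetricSpace M] [MeasurableSpace M]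
    [OpensMeasurableSpace M] {μ : Measure M} [IsFiniteMeasure μ] {b c : ℝ} {r : ℝ≥0∞}
    [Fact (1 < r)] (C C' : ℝ)
    (h : ∀ g : HardySpace μ c r, ∃ G : HardySpace μ b r, G.toL1 = g.toL1 ∧ ‖G‖ ≤ C * ‖g‖)
    (h' : ∀ g : HardySpace μ b r, ∃ G : HardySpace μ c r, G.toL1 = g.toL1 ∧ ‖G‖ ≤ C' * ‖g‖) :
    ∃ e : HardySpace μ c r ≃L[ℂ] HardySpace μ b r, ∀ g, (e g).toL1 = g.toL1 := by
  choose φ hφ hφn using h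
  choose ψ hψ hψn using h'
  let e : HardySpace μ c r ≃ₗ[ℂ] HardySpace μ b r :=
    { toFun := φ
      invFun := ψ
      map_add' := fun x y => HardySpace.toL1_injective (by simp only [map_add, hφ])
      map_smul' := fun z x => HardySpace.toL1_injective (by
        simp only [map_smul, hφ, RingHom.id_apply])
      left_inv := fun x => HardySpace.toL1_injective (by rw [hψ, hφ])
      right_inv := fun x => HardySpace.toL1_injective (by rw [hφ, hψ]) }
  exact ⟨e.toContinuousLinearEquivOfBounds C C' hφn hψn, hφ⟩

theorem BMOSpace.toL1_injective {M : Type*} [MetricSpace M] [MeasurableSpace M]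
    {μ : Measure M} {b : ℝ} {q : ℝ≥0∞} [Fact (1 ≤ q)] :
    Function.Injective (BMOSpace.toL1 : BMOSpace μ b q → Lp ℂ 1 μ) :=
  Subtype.val_injective

theorem exists_bmoSpace_equiv {M : Type*} [MetricSpace M] [MeasurableSpace M]
    {μ : Measure M} {b c : ℝ} {q : ℝ≥0∞} [Fact (1 ≤ q)] (C C' : ℝ≥0) (hC : 1 ≤ C) (hC' : 1 ≤ C')
    (h : ∀ f : Lp ℂ 1 μ, oscNorm μ c q f ≤ C * oscNorm μ b q f)
    (h' : ∀ f : Lp ℂ 1 μ, oscNorm μ b q f ≤ C' * oscNorm μ c q f) :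
    ∃ e : BMOSpace μ b q ≃L[ℂ] BMOSpace μ c q, ∀ f, (e f).toL1 = f.toL1 := by
  have key : ∀ {b c : ℝ} {C : ℝ≥0}, 1 ≤ C →
      (∀ f : Lp ℂ 1 μ, oscNorm μ c q f ≤ C * oscNorm μ b q f) →
      ∀ f : BMOSpace μ b q, ∃ F : BMOSpace μ c q, F.toL1 = f.toL1 ∧ ‖F‖ ≤ C * ‖f‖ := by
    intro b c C hC h f
    obtain ⟨F, hF⟩ := BMOSpace.exists_toL1_eq
      ((h f.toL1).trans_lt (ENNReal.mul_lt_top ENNReal.coe_lt_top f.oscNorm_lt_top))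
    refine ⟨F, hF, ?_⟩
    have h1 := ENNReal.toReal_mono
      (ENNReal.mul_ne_top ENNReal.coe_ne_top f.oscNorm_lt_top.ne) (h f.toL1)
    rw [ENNReal.toReal_mul, ENNReal.coe_toReal] at h1
    rw [BMOSpace.norm_def, BMOSpace.norm_def, hF, mul_add]
    exact add_le_add (le_mul_of_one_le_left (norm_nonneg _) (by exact_mod_cast hC)) h1
  choose φ hφ hφn using key hC h
  choose ψ hψ hψn using key hC' h'
  let e : BMOSpace μ b q ≃ₗ[ℂ] BMOSpace μ c q :=
    { toFun := φ
      invFun := ψ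
      map_add' := fun x y => BMOSpace.toL1_injective (by simp only [map_add, hφ])
      map_smul' := fun z x => BMOSpace.toL1_injective (by
        simp only [map_smul, hφ, RingHom.id_apply])
      left_inv := fun x => BMOSpace.toL1_injective (by rw [hψ, hφ])
      right_inv := fun x => BMOSpace.toL1_injective (by rw [hφ, hψ]) }
  exact ⟨e.toContinuousLinearEquivOfBounds C C' hφn hψn, hφ⟩

theorem HardySpace.exists_toL1_eq_of_radius_le {M : Type*} [MetricSpace M] [MeasurableSpace M]
    {μ : Measure M} [IsFiniteMeasure μ] {b c : ℝ} {r : ℝ≥0∞} (hcb : c ≤ b)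
    (g : HardySpace μ c r) :
    ∃ G : HardySpace μ b r, G.toL1 = g.toL1 ∧ ‖G‖ ≤ ‖g‖ := by
  have key : ∀ l a, IsAtomicDecomposition μ c r g.toL1 l a →
      IsAtomicDecomposition μ b r g.toL1 l a := by
    refine fun l a h => ⟨fun k => (h.1 k).imp_left ?_, h.2⟩
    rintro ⟨x, ρ, hρ, hρc, hrest⟩
    exact ⟨x, ρ, hρ, hρc.trans hcb, hrest⟩
  obtain ⟨l, a, h⟩ := g.exists_decomposition
  obtain ⟨G, hG, -⟩ := HardySpace.exists_toL1_eq (key l a h)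
  refine ⟨G, hG, HardySpace.le_norm fun l a h => ?_⟩
  exact HardySpace.norm_le (by rw [hG]; exact key l a h)

theorem propositionp {M : Type u} [MetricSpace M] [MeasurableSpace M] [BorelSpace M]
    (μ : Measure M) [IsFiniteMeasure μ] [NeZero μ] (hLD : LocallyDoubling μ)
    (R₀ β : ℝ) (hAM : ApproximateMidpoint M R₀ β)
    (r : ℝ≥0∞) [Fact (1 < r)] (q : ℝ≥0∞) [Fact (1 ≤ q)] (hq : q ≠ ∞)
    (b c : ℝ) (hc : R₀ / (1 - β) < c) (hcb : c < b) :
    -- the spaces at the scales `c` and `b` are Banach spaces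
    (CompleteSpace (HardySpace μ c r) ∧ CompleteSpace (HardySpace μ b r) ∧
      CompleteSpace (BMOSpace μ b q) ∧ CompleteSpace (BMOSpace μ c q)) ∧
    -- the identity is an isomorphism of Banach spaces
    (∃ e : HardySpace μ c r ≃L[ℂ] HardySpace μ b r, ∀ g, (e g).toL1 = g.toL1) ∧
    (∃ e : BMOSpace μ b q ≃L[ℂ] BMOSpace μ c q, ∀ f, (e f).toL1 = f.toL1) ∧
    -- John-Nirenberg type inequality; if `N_b^1(f) = 0` the right-hand side is read as `0`
    (∃ κ C : ℝ, 0 < κ ∧ 0 < C ∧ ∀ (f : BMOSpace μ b 1) (x : M) (ρ s : ℝ),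
      0 < ρ → ρ ≤ b → 0 ≤ s →
      (oscNorm μ b 1 f.toL1 ≠ 0 →
        μ.real {y ∈ ball x ρ | s < ‖f.toL1 y - ⨍ z in ball x ρ, f.toL1 z ∂μ‖} ≤
          C * Real.exp (-(κ * s / (oscNorm μ b 1 f.toL1).toReal)) * μ.real (ball x ρ)) ∧
      (oscNorm μ b 1 f.toL1 = 0 →
        μ.real {y ∈ ball x ρ | s < ‖f.toL1 y - ⨍ z in ball x ρ, f.toL1 z ∂μ‖} = 0)) ∧
    -- equivalence of the seminorms `N_b^p` and `N_b^1`, as quantities in `[0, ∞]`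
    (∀ p : ℝ≥0∞, 1 < p → p ≠ ∞ → ∃ C : ℝ≥0, ∀ f : Lp ℂ 1 μ,
      oscNorm μ b 1 f ≤ oscNorm μ b p f ∧ oscNorm μ b p f ≤ C * oscNorm μ b 1 f) := by

  have hb : R₀ / (1 - β) < b := hc.trans hcb
  have hq1 : 1 ≤ q := Fact.out
  refine ⟨⟨completeSpace_HardySpace, completeSpace_HardySpace, completeSpace_BMOSpace b q,
    completeSpace_BMOSpace c q⟩, ?_, ?_, ?_, ?_⟩
  · obtain ⟨C, hC⟩ := exists_hardySpace_norm_le hLD hAM hc r (b := b)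
    refine exists_hardySpace_equiv 1 C (fun g => ?_) hC
    simpa using g.exists_toL1_eq_of_radius_le hcb.le
  · obtain ⟨C, hC1, hC⟩ := oscNorm_le_mul_oscNorm hLD hAM hc hcb.le
    refine exists_bmoSpace_equiv 1 C le_rfl hC1 (fun f => ?_)
      (fun f => hC q f hq1 (L1.integrable_coeFn f))
    simpa using oscNorm_mono_radius hcb.le q f
  · obtain ⟨κ, C, hκ, hC, h⟩ := hLD.exists_john_nirenberg hAM hb
    exact ⟨κ, C, hκ, hC, fun f x ρ s hρ hρb hs =>
      h f.toL1 x ρ s (L1.integrable_coeFn _) f.oscNorm_lt_top hρ hρb hs⟩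
  · intro p hp hp'
    obtain ⟨C, hC⟩ := hLD.exists_oscNorm_le_mul hAM hb hp'
    exact ⟨C, fun f => ⟨hLD.oscNorm_mono_exponent b hp.le (L1.integrable_coeFn f),
      hC f (L1.integrable_coeFn f)⟩⟩
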